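/- **Setting.** A continuous-time Markov decision process (CTMDP) $\mathcal M$ consists of a finite set $L$ of locations, a goal region $G\subseteq L$, a finite set $\mathit{Act}$ of actions, rates $\mathbf R(l,a,l')\ge 0$ for $l,l'\in L$, $a\in\mathit{Act}$, and an initial distribution $\nu$ on $L$. Put $\mathbf R(l,a,L)=\sum_{l'}\mathbf R(l,a,l')$. The action $a$ is enabled in $l$ if $\mathbf R(l,a,L)>0$; every location has an enabled action. The goal region is absorbing: $\mathbf R(l,a,l')=0$ for $l\in G$, $l'\notin G$. Fix a time bound $T\ge 0$. A timed path is $\pi=l_0\xrightarrow{a_0,t_0}l_1\xrightarrow{a_1,t_1}\cdots\xrightarrow{a_{n-1},t_{n-1}}l_n$ with $0\le t_0\le\dots\le t_{n-1}\le T$. A timed history-dependent randomised (THR) scheduler $S$ maps a timed path $\pi$ ending in $l$ and a time $t$ to a distribution $S(\pi,t)$ on the actions enabled in $l$. It is timed positional deterministic (TPD) if $S(\pi,t)$ is a single action $\sigma(l,t)$ that depends only on $l$ and $t$. Under $S$, after the history $\pi$ ending in $l$, a transition to $l'$ with action $a$ occurs at time $t$ with rate $S(\pi,t)(a)\,\mathbf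 R(l,a,l')$. For $S$ Borel in the times this gives a probability measure on complete timed paths (the paths of all transitions up to time $T$), started according to $\nu$ at time $0$. $\mathit{Pr}_S^{\mathcal M}(T)$ denotes the probability of visiting $G$ within time $T$ (time-bounded reachability); the probability of avoiding $G$ up to time $T$ is the time-bounded safety probability. A scheduler is cylindrical if, for some finite partition of $[0,T]$ into intervals $[0,t_0],(t_0,t_1],\dots,(t_{m-1},t_m]$ with $t_m=T$, its decisions depend on the times in $\pi$ and on the current time only through the intervals that contain them. The difference measure $d(D,E)$ of two schedulers is the probability of reaching a fresh location $g$ within time $T$ in the following modified CTMDP, with goal region $\{g\}$. On each history of $\mathcal M$ ending in $l$, each action $a$ is chosen with the smaller of the probabilities that $D$ and $E$ give to it. The remaining probability is given to a fresh action $(a_D,a_E)$ that leads to $g$ with rate $\mathbf R(l,a_D,L)+\mathbf R(l,a_E,L)$, where $a_D$ (resp. $a_E$) has maximal $\mathbf R(l,\cdot,L)$ among the actions to which $D$ gives more probability than $E$ (resp. $E$ more than $D$), ties being broken in a fixed way. The location $g$ is never left. A measurable scheduler is a scheduler, Borel in the times, that is the limit of a sequence of cylindrical schedulers with respect to $d$.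 **Theorem.** For every CTMDP $\mathcal M$ and every time bound $T\ge 0$ there is a measurable TPD scheduler $S$ that is optimal for minimum time-bounded reachability in the class of measurable THR schedulers: $\mathit{Pr}_S^{\mathcal M}(T)\le \mathit{Pr}_{S'}^{\mathcal M}(T)$ for every measurable THR scheduler $S'$. Likewise, $S$ maximises the time-bounded safety probability in this class. -/

import Mathlib

open scoped NNReal ENNReal
open Filter Topology MeasureTheory

noncomputable section

/-- A (traditional) continuous-time Markov decision process: finitely many locations, all of them
continuous, finitely many actions, a goal region, a rate matrix and an initial distribution. -/
structure CTMDP (L Act : Type*) [Fintype L] [Fintype Act] where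
  /-- goal locations -/
  goal : Set L
  /-- rate matrix -/
  rate : L → Act → L → ℝ≥0
  /-- initial distribution -/
  init : L → ℝ≥0
  sum_init : ∑ l, init l = 1
  /-- every location has an enabled action, i.e. one with positive total rate -/
  exists_enabled : ∀ l, ∃ a, 0 < ∑ l', rate l a l'
  /-- the goal region is absorbing -/
  absorbing : ∀ l ∈ goal, ∀ a, ∀ l' ∉ goal, rate l a l' = 0

/-- A timed path `l₀ --(a₀,t₀)--> l₁ --(a₁,t₁)--> ... --> lₙ` with `n` transitions. The order
`0 ≤ t₀ ≤ t₁ ≤ ... ≤ T` of the times is enforced by the path density below. -/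
structure TimedPath (L Act : Type*) (n : ℕ) where
  loc : Fin (n + 1) → L
  act : Fin n → Act
  time : Fin n → ℝ

namespace TimedPath

variable {L Act : Type*}

/-- the last location of a path -/
def last {n : ℕ} (π : TimedPath L Act n) : L := π.loc (Fin.last n)

/-- the time at which the last location was entered (`0` if no transition was taken) -/
def now : {n : ℕ} → TimedPath L Act n → ℝ
  | 0, _ => 0
  | n + 1, π => π.time (Fin.last n)

/-- the path without its last transition -/
def dropLast {n : ℕ} (π : TimedPath L Act (n + 1)) : TimedPath L Act n where
  loc i := π.loc i.castSucc
  act i := π.act i.castSucc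
  time i := π.time i.castSucc

/-- the path visits the set `G` of locations -/
def Visits {n : ℕ} (G : Set L) (π : TimedPath L Act n) : Prop := ∃ i, π.loc i ∈ G

end TimedPath

namespace CTMDP

variable {L Act : Type*} [Fintype L] [Fintype Act]

/-- the exit rate `R(l,a,L)` -/
def exitRate (M : CTMDP L Act) (l : L) (a : Act) : ℝ≥0 := ∑ l', M.rate l a l'

/-- the actions enabled in `l` -/
def Enabled (M : CTMDP L Act) (l : L) (a : Act) : Prop := 0 < M.exitRate l a

/-- A timed history-dependent randomised (THR) scheduler: it maps a timed path and the current
time to a distribution over the actions enabled in the last location of the path. (No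
measurability is required here.) -/
structure Scheduler (M : CTMDP L Act) where
  prob : {n : ℕ} → TimedPath L Act n → ℝ → Act → ℝ≥0
  sum_prob : ∀ {n : ℕ} (π : TimedPath L Act n) (t : ℝ), ∑ a, prob π t a = 1
  enabled : ∀ {n : ℕ} (π : TimedPath L Act n) (t : ℝ) (a : Act),
    prob π t a ≠ 0 → M.Enabled π.last a

namespace Scheduler

variable {M : CTMDP L Act}

open Classical in
/-- timed positional deterministic (TPD) schedulers: the decision is a single action that depends
only on the current location and the time -/
def IsTPD (S : M.Scheduler) : Prop :=
  ∃ σ : L → ℝ → Act, ∀ (n : ℕ) (π : TimedPath L Act n) (t : ℝ) (a : Act),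
    S.prob π t a = if a = σ π.last t then 1 else 0

/-! ### The probability measure on complete timed paths -/

/-- the expected rate at which the last location of `π` is left at time `t` -/
def totalRate (S : M.Scheduler) {n : ℕ} (π : TimedPath L Act n) (t : ℝ) : ℝ :=
  ∑ a, (S.prob π t a : ℝ) * (M.exitRate π.last a : ℝ)

/-- the probability that the last location of `π`, entered at time `π.now`, is not left before
time `t` -/
def survival (S : M.Scheduler) {n : ℕ} (π : TimedPath L Act n) (t : ℝ) : ℝ≥0∞ :=
  ENNReal.ofReal (Real.exp (-∫ u in π.now..t, S.totalRate π u))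

open Classical in
/-- the density, with respect to counting measure for locations and actions and Lebesgue measure
for the transition times, of the event that the first `n` transitions are those of `π`, and
that they all take place in `[0,T]` -/
def stepDensity (S : M.Scheduler) (T : ℝ) : {n : ℕ} → TimedPath L Act n → ℝ≥0∞
  | 0, π => (M.init (π.loc 0) : ℝ≥0∞)
  | n + 1, π =>
    stepDensity S T π.dropLast *
      if π.dropLast.now ≤ π.now ∧ π.now ≤ T then
        S.survival π.dropLast π.now *
          (S.prob π.dropLast π.now (π.act (Fin.last n)) : ℝ≥0∞) *
          (M.rate π.dropLast.last (π.act (Fin.last n)) π.last : ℝ≥0∞)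
      else 0

open Classical in
/-- the probability that the complete timed path (the path of all transitions up to time `T`)
belongs to the set `A` of timed paths -/
def pathProb (S : M.Scheduler) (T : ℝ) (A : {n : ℕ} → TimedPath L Act n → Prop) : ℝ≥0∞ :=
  ∑' n : ℕ, ∑ loc : Fin (n + 1) → L, ∑ act : Fin n → Act, ∫⁻ time : Fin n → ℝ,
    if A ⟨loc, act, time⟩ then
      S.stepDensity T ⟨loc, act, time⟩ * S.survival ⟨loc, act, time⟩ T
    else 0

/-- the time-bounded reachability probability: the goal region is reached within time `T` -/
def reachProb (S : M.Scheduler) (T : ℝ) : ℝ≥0∞ :=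
  S.pathProb T (fun π => π.Visits M.goal)

/-- the time-bounded safety probability: the goal region is avoided up to time `T` -/
def safeProb (S : M.Scheduler) (T : ℝ) : ℝ≥0∞ :=
  S.pathProb T (fun π => ¬ π.Visits M.goal)

/-! ### Cylindrical schedulers -/

/-- The index of the cell that contains `t` in the partition `[0,t₀], (t₀,t₁], ..., (tₙ₋₁,tₙ]`
given by the set `B = {t₀ < t₁ < ... < tₙ}`. -/
def cell (B : Finset ℝ) (t : ℝ) : ℕ := (B.filter (fun b => b < t)).card

/-- Cylindrical schedulers: for some finite partition of `[0,T]` into intervals, the decisions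
depend on the times in the path and on the current time only through their cells. -/
def IsCylindrical (S : M.Scheduler) (T : ℝ) : Prop :=
  ∃ B : Finset ℝ, (∀ b ∈ B, 0 ≤ b ∧ b ≤ T) ∧ T ∈ B ∧
    ∀ (n : ℕ) (π π' : TimedPath L Act n) (t t' : ℝ),
      π.loc = π'.loc → π.act = π'.act → (∀ i, cell B (π.time i) = cell B (π'.time i)) →
      cell B t = cell B t' → S.prob π t = S.prob π' t'

end Scheduler

/-! ### The difference measure between schedulers -/

/-- The CTMDP used to compare two schedulers. `none` is a fresh location, which is the only goal
location. The actions are the old actions, a fresh action `(a, b)` for each pair of old actions,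
which leads to the fresh location with rate `R(l,a,L) + R(l,b,L)`, and the action `none`, the
only one enabled in the fresh location. -/
def diff (M : CTMDP L Act) : CTMDP (Option L) (Option (Act ⊕ Act × Act)) where
  goal := {none}
  rate
    | some l, some (Sum.inl a), some l' => M.rate l a l'
    | some l, some (Sum.inr (a, b)), none => M.exitRate l a + M.exitRate l b
    | none, none, none => 1
    | _, _, _ => 0
  init
    | some l => M.init l
    | none => 0
  sum_init := by simp [Fintype.sum_option, M.sum_init]
  exists_enabled := by
    rintro (_ | l)
    · exact ⟨none, by simp [Fintype.sum_option]⟩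
    · obtain ⟨a, ha⟩ := M.exists_enabled l
      exact ⟨some (Sum.inl a), by simpa [Fintype.sum_option] using ha⟩
  absorbing := by
    rintro l hl a (_ | l') hl'
    · simp at hl'
    · obtain rfl : l = none := by simpa using hl
      rcases a with _ | (a | ⟨a, b⟩) <;> rfl

open Classical in
/-- an action of maximal exit rate among those to which `p` gives more weight than `q`, with a
fixed way to break ties (and some enabled action if there is none) -/
def pick (M : CTMDP L Act) (l : L) (p q : Act → ℝ≥0) : Act :=
  if h : (Finset.univ.filter fun a => q a < p a).Nonempty then
    (Finset.exists_max_image (Finset.univ.filter fun a => q a < p a) (M.exitRate l) h).choose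
  else (M.exists_enabled l).choose

open Classical in
/-- The combination of two decisions `p` and `q`: each old action gets the weight on which the
two decisions agree, and the remaining weight goes to one fresh action. -/
def diffDecision (M : CTMDP L Act) (l : L) (p q : Act → ℝ≥0) :
    Option (Act ⊕ Act × Act) → ℝ≥0
  | none => 0
  | some (Sum.inl a) => min (p a) (q a)
  | some (Sum.inr ab) =>
    if ab = (M.pick l p q, M.pick l q p) then 1 - ∑ a, min (p a) (q a) else 0

/-- a path of `M`, seen as a path of `M.diff` -/
def _root_.TimedPath.lift {n : ℕ} (π : TimedPath L Act n) :
    TimedPath (Option L) (Option (Act ⊕ Act × Act)) n where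
  loc i := some (π.loc i)
  act i := some (Sum.inl (π.act i))
  time := π.time

theorem pick_enabled (M : CTMDP L Act) (l : L) (p q : Act → ℝ≥0)
    (hp : ∀ a, p a ≠ 0 → M.Enabled l a) : M.Enabled l (M.pick l p q) := by
  classical
  unfold pick
  split_ifs with h
  · have h1 := (Finset.exists_max_image (Finset.univ.filter fun a => q a < p a)
      (M.exitRate l) h).choose_spec.1
    refine hp _ ?_
    have h2 := (Finset.mem_filter.1 h1).2
    exact (lt_of_le_of_lt zero_le h2).ne'
  · exact (M.exists_enabled l).choose_spec

theorem sum_diffDecision (M : CTMDP L Act) (l : L) (p q : Act → ℝ≥0) (hp : ∑ a, p a = 1) :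
    ∑ x, M.diffDecision l p q x = 1 := by
  classical
  have h : ∑ a, min (p a) (q a) ≤ 1 := hp ▸ Finset.sum_le_sum fun a _ => min_le_left _ _
  simp only [Fintype.sum_option, Fintype.sum_sum_type, diffDecision, zero_add]
  rw [Finset.sum_ite_eq' Finset.univ]
  simpa using add_tsub_cancel_of_le h

theorem diffDecision_enabled (M : CTMDP L Act) (l : L) (p q : Act → ℝ≥0)
    (hp : ∀ a, p a ≠ 0 → M.Enabled l a) (x : Option (Act ⊕ Act × Act))
    (hx : M.diffDecision l p q x ≠ 0) : M.diff.Enabled (some l) x := by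
  classical
  rcases x with _ | (a | ab)
  · simp [diffDecision] at hx
  · have : p a ≠ 0 := by
      intro h
      simp [diffDecision, h] at hx
    have h2 := hp a this
    simpa [Enabled, exitRate, diff, Fintype.sum_option] using h2
  · have h1 : ab = (M.pick l p q, M.pick l q p) := by
      by_contra h
      simp [diffDecision, h] at hx
    have h2 : 0 < M.exitRate l (M.pick l p q) := M.pick_enabled l p q hp
    subst h1
    change 0 < ∑ l', M.diff.rate (some l) _ l'
    rw [Fintype.sum_option]
    exact lt_of_lt_of_le (lt_of_lt_of_le h2 le_self_add) le_self_add

namespace Scheduler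

variable {M : CTMDP L Act}

open Classical in
/-- The difference scheduler of `D` and `E`: on the paths of `M` it combines the decisions of `D`
and `E`; on all other paths (which have reached the fresh location, or have probability `0`) it
takes some enabled action. -/
def diffScheduler (D E : M.Scheduler) : M.diff.Scheduler where
  prob π t x :=
    if h : ∃ π₀ : TimedPath L Act _, π₀.lift = π then
      M.diffDecision h.choose.last (D.prob h.choose t) (E.prob h.choose t) x
    else if x = (M.diff.exists_enabled π.last).choose then 1 else 0
  sum_prob π t := by
    by_cases h : ∃ π₀ : TimedPath L Act _, π₀.lift = π
    · simp only [h, dite_true]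
      exact M.sum_diffDecision _ _ _ (D.sum_prob _ _)
    · simp [h]
  enabled π t x hx := by
    by_cases h : ∃ π₀ : TimedPath L Act _, π₀.lift = π
    · simp only [h, dite_true] at hx
      have h1 := M.diffDecision_enabled _ _ _ (D.enabled h.choose t) x hx
      have h2 : π.last = some h.choose.last := by
        conv_lhs => rw [← h.choose_spec]
        rfl
      rw [h2]
      exact h1
    · simp only [h, dite_false] at hx
      have h1 : x = (M.diff.exists_enabled π.last).choose := (ite_ne_right_iff.1 hx).1
      rw [h1]
      exact (M.diff.exists_enabled π.last).choose_spec

/-- the difference measure: the probability that `D` and `E` act observably different within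
time `T` -/
def schedDist (D E : M.Scheduler) (T : ℝ) : ℝ≥0∞ := (D.diffScheduler E).reachProb T

/-! ### Measurable schedulers -/

/-- decisions are Borel functions of the transition times and of the current time -/
def IsBorel (S : M.Scheduler) : Prop :=
  ∀ (n : ℕ) (loc : Fin (n + 1) → L) (act : Fin n → Act) (a : Act),
    Measurable fun p : (Fin n → ℝ) × ℝ => S.prob ⟨loc, act, p.1⟩ p.2 a

/-- Measurable schedulers: limits of sequences of cylindrical schedulers with respect to the
difference measure (represented by a Borel function, so that all probabilities make sense). -/
def IsMeasurable (S : M.Scheduler) (T : ℝ) : Prop :=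
  S.IsBorel ∧ ∃ C : ℕ → M.Scheduler, (∀ k, (C k).IsCylindrical T) ∧
    Tendsto (fun k => (C k).schedDist S T) atTop (𝓝 0)

end Scheduler

end CTMDP

end

/-!
The optimal scheduler is found by dynamic programming. Let `v l t` be the solution, backwards from
time `T`, of the Bellman equation `-v l' = min_a ∑ l', R(l,a,l') (v l' - v l)`, the minimum being
taken over the enabled actions, with the indicator function of the goal region as terminal value
(`CTMDP.exists_bellman_solution`). The right-hand side is Lipschitz, and the solution stays in the
unit interval, so that it exists on all of `[0,T]`. The scheduler `S` takes in the location `l` at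
time `t` an action `σ l t` that attains the minimum; as there are finitely many actions, `σ` can be
chosen to be Borel (`CTMDP.exists_measurable_argmin`).

Optimality is a verification argument. Along a path that stays in its last location, the survival
probability times `v` is absolutely continuous, and its derivative compares the decrease of `v` with
the expected gain by a transition, the `generator`. Hence the expected value of `v` at the `n`-th
transition, plus the expected terminal value of the paths that have stopped before, is monotone in
`n`. The first part tends to `0`, because the weight `exp (-2ct)` of the transition times, with `c` a
bound of the exit rates, is at least halved by each transition. This bounds the probability of a
set of paths from above (`IsBorel.pathProb_le`) and from below (`IsBorel.le_pathProb`). For `v` and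
`1 - v`, these bounds hold with one inequality for every Borel scheduler, and with both for `S`.

It remains to see that `S` is a limit of cylindrical schedulers. By inner regularity, `σ` coincides
up to a set of times of small measure with a policy that is constant on the cells of a fine partition
(`exists_cylindrical_approx`), and the upper bound of the verification argument, applied to the
CTMDP that compares two schedulers, shows that the difference measure is at most proportional to the
measure of the times at which the decisions differ (`schedDist_le`).
-/

noncomputable section

/-! ### Integration over timed paths -/

namespace TimedPath

variable {L Act : Type*}

/-- The path `π` prolonged by the transition `--(a,t)--> l`. -/
def snoc {n : ℕ} (π : TimedPath L Act n) (l : L) (a : Act) (t : ℝ) : TimedPath L Act (n + 1) where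
  loc := Fin.snoc (α := fun _ => L) π.loc l
  act := Fin.snoc (α := fun _ => Act) π.act a
  time := Fin.snoc (α := fun _ => ℝ) π.time t

@[simp] theorem dropLast_snoc {n : ℕ} (π : TimedPath L Act n) (l : L) (a : Act) (t : ℝ) :
    (π.snoc l a t).dropLast = π := by
  simp [snoc, dropLast]

@[simp] theorem last_snoc {n : ℕ} (π : TimedPath L Act n) (l : L) (a : Act) (t : ℝ) :
    (π.snoc l a t).last = l := by
  simp [snoc, last]

@[simp] theorem now_snoc {n : ℕ} (π : TimedPath L Act n) (l : L) (a : Act) (t : ℝ) :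
    (π.snoc l a t).now = t := by
  simp [snoc, now]

theorem measurable_now {n : ℕ} (loc : Fin (n + 1) → L) (act : Fin n → Act) :
    Measurable fun time : Fin n → ℝ => (⟨loc, act, time⟩ : TimedPath L Act n).now := by
  cases n with
  | zero => exact measurable_const
  | succ n => exact measurable_pi_apply _

/-- The integral of `f` over the paths with `n` transitions, with respect to counting measure for
locations and actions and Lebesgue measure for the transition times. -/
def integral [Fintype L] [Fintype Act] (n : ℕ) (f : TimedPath L Act n → ℝ≥0∞) : ℝ≥0∞ :=
  ∑ loc : Fin (n + 1) → L, ∑ act : Fin n → Act, ∫⁻ time : Fin n → ℝ, f ⟨loc, act, time⟩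

/-- A function of paths is Borel in the transition times. -/
def BorelInTimes {n : ℕ} (f : TimedPath L Act n → ℝ≥0∞) : Prop :=
  ∀ loc act, Measurable fun time => f ⟨loc, act, time⟩

section integral

variable [Fintype L] [Fintype Act]

theorem integral_mono {n : ℕ} {f g : TimedPath L Act n → ℝ≥0∞} (h : ∀ π, f π ≤ g π) :
    integral n f ≤ integral n g :=
  Finset.sum_le_sum fun _ _ => Finset.sum_le_sum fun _ _ => lintegral_mono fun _ => h _

theorem integral_add {n : ℕ} {f g : TimedPath L Act n → ℝ≥0∞} (hf : BorelInTimes f) :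
    integral n (fun π => f π + g π) = integral n f + integral n g := by
  simp only [integral, ← Finset.sum_add_distrib]
  exact Finset.sum_congr rfl fun _ _ => Finset.sum_congr rfl fun _ _ =>
    lintegral_add_left (hf _ _) _

theorem integral_const_mul {n : ℕ} {f : TimedPath L Act n → ℝ≥0∞} (c : ℝ≥0∞)
    (hf : BorelInTimes f) : integral n (fun π => c * f π) = c * integral n f := by
  simp only [integral, Finset.mul_sum]
  exact Finset.sum_congr rfl fun _ _ => Finset.sum_congr rfl fun _ _ =>
    lintegral_const_mul _ (hf _ _)

theorem integral_zero (f : TimedPath L Act 0 → ℝ≥0∞) :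
    integral 0 f = ∑ l, f ⟨fun _ => l, Fin.elim0, Fin.elim0⟩ := by
  rw [integral, ← (Equiv.funUnique (Fin 1) L).symm.sum_comp]
  refine Finset.sum_congr rfl fun l _ => ?_
  rw [Fintype.sum_unique, lintegral_unique]
  simp only [volume_pi, Measure.pi_empty_univ, mul_one]
  congr 1

/-- Integration over the paths with `n + 1` transitions, the last transition innermost. -/
theorem integral_succ {n : ℕ} {f : TimedPath L Act (n + 1) → ℝ≥0∞} (hf : BorelInTimes f) :
    integral (n + 1) f = integral n fun π => ∑ l, ∑ a, ∫⁻ t, f (π.snoc l a t) := by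
  have key : ∀ (loc : Fin (n + 1) → L) (act : Fin n → Act) (l : L) (a : Act),
      ∫⁻ time, f ⟨Fin.snoc (α := fun _ => L) loc l, Fin.snoc (α := fun _ => Act) act a, time⟩
        = ∫⁻ time, ∫⁻ t, f ((⟨loc, act, time⟩ : TimedPath L Act n).snoc l a t) := by
    intro loc act l a
    rw [← ((volume_preserving_piFinSuccAbove (fun _ : Fin (n + 1) => ℝ) (Fin.last n)).symm
      _).lintegral_comp (hf _ _), Measure.volume_eq_prod, lintegral_prod_symm]
    · refine lintegral_congr fun time => lintegral_congr fun t => ?_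
      simp [snoc, MeasurableEquiv.piFinSuccAbove, Fin.insertNthEquiv]
    · exact ((hf _ _).comp (MeasurableEquiv.measurable _)).aemeasurable
  have meas : ∀ (loc : Fin (n + 1) → L) (act : Fin n → Act) (l : L) (a : Act),
      Measurable fun time => ∫⁻ t, f ((⟨loc, act, time⟩ : TimedPath L Act n).snoc l a t) := by
    intro loc act l a
    refine Measurable.lintegral_prod_right' (f := fun p : (Fin n → ℝ) × ℝ =>
      f ((⟨loc, act, p.1⟩ : TimedPath L Act n).snoc l a p.2)) ?_
    refine (hf (Fin.snoc (α := fun _ => L) loc l) (Fin.snoc (α := fun _ => Act) act a)).comp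
      (g := fun time => f ⟨_, _, time⟩) (measurable_pi_iff.2 fun i => ?_)
    refine Fin.lastCases ?_ (fun i => ?_) i
    · simpa using measurable_snd
    · simpa using! (measurable_pi_apply i).comp measurable_fst
  simp only [integral]
  rw [← (Fin.snocEquiv fun _ => L).sum_comp, Fintype.sum_prod_type_right]
  refine Finset.sum_congr rfl fun loc _ => ?_
  have : ∀ l : L, ∑ act : Fin (n + 1) → Act,
      ∫⁻ time, f ⟨Fin.snocEquiv (fun _ => L) (l, loc), act, time⟩ = ∑ act : Fin n → Act, ∑ a,
        ∫⁻ time, ∫⁻ t, f ((⟨loc, act, time⟩ : TimedPath L Act n).snoc l a t) := by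
    intro l
    rw [← (Fin.snocEquiv fun _ => Act).sum_comp, Fintype.sum_prod_type_right]
    exact Finset.sum_congr rfl fun act _ => Finset.sum_congr rfl fun a _ => key _ _ _ _
  simp only [this]
  rw [Finset.sum_comm]
  refine Finset.sum_congr rfl fun act _ => ?_
  rw [lintegral_finsetSum _ fun l _ => Finset.measurable_fun_sum _ fun a _ => meas _ _ _ _]
  refine Finset.sum_congr rfl fun l _ => ?_
  rw [lintegral_finsetSum _ fun a _ => meas _ _ _ _]

end integral

end TimedPath

namespace CTMDP

variable {L Act : Type*} [Fintype L] [Fintype Act] {M : CTMDP L Act}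

namespace Scheduler

variable {S : M.Scheduler}

theorem IsBorel.measurable_prob (hS : S.IsBorel) {n : ℕ} (π : TimedPath L Act n) (a : Act) :
    Measurable fun t => S.prob π t a :=
  (hS n π.loc π.act a).comp (measurable_prodMk_left (x := π.time))

theorem IsBorel.measurable_totalRate_prod (hS : S.IsBorel) {n : ℕ} (loc : Fin (n + 1) → L)
    (act : Fin n → Act) :
    Measurable fun p : (Fin n → ℝ) × ℝ => S.totalRate ⟨loc, act, p.1⟩ p.2 :=
  Finset.measurable_fun_sum _ fun a _ =>
    (measurable_coe_nnreal_real.comp (hS n loc act a)).mul_const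
      (M.exitRate (loc (Fin.last n)) a : ℝ)

theorem IsBorel.measurable_totalRate (hS : S.IsBorel) {n : ℕ} (π : TimedPath L Act n) :
    Measurable fun t => S.totalRate π t :=
  (hS.measurable_totalRate_prod π.loc π.act).comp (measurable_prodMk_left (x := π.time))

theorem IsBorel.measurable_survival_prod (hS : S.IsBorel) {n : ℕ} (loc : Fin (n + 1) → L)
    (act : Fin n → Act) :
    Measurable fun p : (Fin n → ℝ) × ℝ => S.survival ⟨loc, act, p.1⟩ p.2 := by
  have hr : Measurable fun q : ((Fin n → ℝ) × ℝ) × ℝ => S.totalRate ⟨loc, act, q.1.1⟩ q.2 :=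
    (hS.measurable_totalRate_prod loc act).comp
      (measurable_fst.fst.prodMk measurable_snd)
  have hnow := TimedPath.measurable_now loc act
  have key : ∀ a b : (Fin n → ℝ) × ℝ → ℝ, Measurable a → Measurable b →
      Measurable fun p : (Fin n → ℝ) × ℝ =>
        ∫ u in Set.Ioc (a p) (b p), S.totalRate ⟨loc, act, p.1⟩ u := by
    intro a b ha hb
    have hs : MeasurableSet {q : ((Fin n → ℝ) × ℝ) × ℝ | a q.1 < q.2 ∧ q.2 ≤ b q.1} :=
      (measurableSet_lt (ha.comp measurable_fst) measurable_snd).inter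
        (measurableSet_le measurable_snd (hb.comp measurable_fst))
    have h := ((hr.indicator hs).stronglyMeasurable.integral_prod_right'
      (ν := (volume : Measure ℝ))).measurable
    convert h using 2 with p
    rw [← integral_indicator measurableSet_Ioc]
    rfl
  unfold survival
  simp only [intervalIntegral]
  exact ENNReal.measurable_ofReal.comp (Real.measurable_exp.comp
    ((key _ _ (hnow.comp measurable_fst) measurable_snd).sub
      (key _ _ measurable_snd (hnow.comp measurable_fst))).neg)

theorem IsBorel.measurable_survival (hS : S.IsBorel) {n : ℕ} (π : TimedPath L Act n) :
    Measurable fun t => S.survival π t := by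
  have h := (hS.measurable_survival_prod π.loc π.act).comp (measurable_prodMk_left (x := π.time))
  exact h

theorem IsBorel.borelInTimes_survival (hS : S.IsBorel) (T : ℝ) {n : ℕ} :
    TimedPath.BorelInTimes fun π : TimedPath L Act n => S.survival π T := by
  intro loc act
  have h := (hS.measurable_survival_prod loc act).comp (measurable_prodMk_right (y := T))
  exact h

theorem stepDensity_succ (T : ℝ) {n : ℕ} (π : TimedPath L Act (n + 1)) :
    S.stepDensity T π = S.stepDensity T π.dropLast *
      (Set.Icc π.dropLast.now T).indicator (fun t => S.survival π.dropLast t *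
          (S.prob π.dropLast t (π.act (Fin.last n)) : ℝ≥0∞) *
          (M.rate π.dropLast.last (π.act (Fin.last n)) π.last : ℝ≥0∞)) π.now := by
  classical
  rw [stepDensity, Set.indicator_apply]
  congr

theorem stepDensity_snoc (T : ℝ) {n : ℕ} (π : TimedPath L Act n) (l : L) (a : Act) (t : ℝ) :
    S.stepDensity T (π.snoc l a t) = S.stepDensity T π *
      (Set.Icc π.now T).indicator
        (fun t => S.survival π t * (S.prob π t a : ℝ≥0∞) * (M.rate π.last a l : ℝ≥0∞)) t := by
  have : (π.snoc l a t).act (Fin.last n) = a := by simp [TimedPath.snoc]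
  rw [stepDensity_succ, TimedPath.dropLast_snoc, TimedPath.now_snoc, TimedPath.last_snoc, this]

theorem IsBorel.borelInTimes_stepDensity (hS : S.IsBorel) (T : ℝ) {n : ℕ} :
    TimedPath.BorelInTimes fun π : TimedPath L Act n => S.stepDensity T π := by
  induction n with
  | zero => exact fun loc act => measurable_const (a := (M.init (loc 0) : ℝ≥0∞))
  | succ n ih =>
    classical
    intro loc act
    have hd : Measurable fun time : Fin (n + 1) → ℝ => fun i : Fin n => time i.castSucc :=
      measurable_pi_iff.2 fun i => measurable_pi_apply _
    have hp := hd.prodMk (measurable_pi_apply (Fin.last n))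
    have hnow := TimedPath.measurable_now (fun i => loc i.castSucc) fun i : Fin n => act i.castSucc
    refine ((ih (fun i => loc i.castSucc) fun i => act i.castSucc).comp hd).mul
      (Measurable.ite ?_ ?_ measurable_const)
    · exact (measurableSet_le (hnow.comp hd) (measurable_pi_apply (Fin.last n))).inter
        (measurableSet_le (measurable_pi_apply (Fin.last n)) measurable_const)
    · exact (((hS.measurable_survival_prod (fun i => loc i.castSucc)
          fun i => act i.castSucc).comp hp).mul
        (measurable_coe_nnreal_ennreal.comp ((hS n (fun i => loc i.castSucc)
          (fun i => act i.castSucc) (act (Fin.last n))).comp hp))).mul_const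
          (M.rate (loc (Fin.last n).castSucc) (act (Fin.last n)) (loc (Fin.last (n + 1))) : ℝ≥0∞)

theorem now_mem_of_stepDensity_ne_zero {T : ℝ} (hT : 0 ≤ T) {n : ℕ} {π : TimedPath L Act n}
    (h : S.stepDensity T π ≠ 0) : π.now ∈ Set.Icc 0 T := by
  induction n with
  | zero => exact ⟨le_rfl, hT⟩
  | succ n ih =>
    rw [stepDensity_succ] at h
    have h1 := Set.mem_of_indicator_ne_zero (right_ne_zero_of_mul h)
    exact ⟨(ih (left_ne_zero_of_mul h)).1.trans h1.1, h1.2⟩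

theorem rate_ne_zero_of_stepDensity_ne_zero {T : ℝ} {n : ℕ} {π : TimedPath L Act (n + 1)}
    (h : S.stepDensity T π ≠ 0) : S.stepDensity T π.dropLast ≠ 0 ∧
      S.prob π.dropLast π.now (π.act (Fin.last n)) ≠ 0 ∧
      M.rate π.dropLast.last (π.act (Fin.last n)) π.last ≠ 0 := by
  rw [stepDensity_succ] at h
  refine ⟨left_ne_zero_of_mul h, ?_⟩
  have h2 := right_ne_zero_of_mul h
  rw [Set.indicator_of_mem (Set.mem_of_indicator_ne_zero h2)] at h2
  exact ⟨by simpa using right_ne_zero_of_mul (left_ne_zero_of_mul h2),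
    by simpa using right_ne_zero_of_mul h2⟩

/-- As the goal region is absorbing, almost every path that visits it ends in it. -/
theorem visits_goal_iff {T : ℝ} {n : ℕ} {π : TimedPath L Act n}
    (h : S.stepDensity T π ≠ 0) : π.Visits M.goal ↔ π.last ∈ M.goal := by
  refine ⟨?_, fun h => ⟨_, h⟩⟩
  induction n with
  | zero =>
    rintro ⟨i, hi⟩
    rwa [show i = Fin.last 0 from Fin.ext (by simp)] at hi
  | succ n ih =>
    rintro ⟨i, hi⟩
    obtain ⟨h1, -, h2⟩ := rate_ne_zero_of_stepDensity_ne_zero h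
    induction i using Fin.lastCases with
    | last => exact hi
    | cast i =>
      by_contra hl
      exact h2 (M.absorbing _ (ih h1 ⟨i, hi⟩) _ _ hl)

end Scheduler

end CTMDP

/-! ### Verification of value functions -/

/-- The exponential of an integral of a bounded nonnegative rate is absolutely continuous. -/
theorem absolutelyContinuousOnInterval_exp_neg_integral {r : ℝ → ℝ} {K s T : ℝ}
    (hr : Measurable r) (hr0 : ∀ t, 0 ≤ r t) (hrK : ∀ t, r t ≤ K) (hsT : s ≤ T) :
    AbsolutelyContinuousOnInterval (fun t => Real.exp (-∫ u in s..t, r u)) s T := by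
  have hK : 0 ≤ K := (hr0 0).trans (hrK 0)
  have hint : ∀ a b : ℝ, IntervalIntegrable r volume a b := fun a b =>
    (intervalIntegrable_const (c := K)).mono_fun hr.aestronglyMeasurable
      (ae_of_all _ fun t => by
        simpa [abs_of_nonneg (hr0 t), abs_of_nonneg hK] using hrK t)
  have hexp : LipschitzOnWith 1 Real.exp (Set.Iic 0) := by
    refine Convex.lipschitzOnWith_of_nnnorm_deriv_le (fun x _ => Real.differentiableAt_exp) ?_
      (convex_Iic 0)
    intro x hx
    rw [Real.deriv_exp, ← NNReal.coe_le_coe]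
    simpa using hx
  refine LipschitzOnWith.absolutelyContinuousOnInterval (K := ⟨K, hK⟩) ?_
  refine LipschitzOnWith.of_dist_le_mul fun x hx y hy => ?_
  rw [Set.uIcc_of_le hsT] at hx hy
  have hn : ∀ x ∈ Set.Icc s T, -∫ u in s..x, r u ∈ Set.Iic 0 := fun x hx =>
    neg_nonpos.2 (intervalIntegral.integral_nonneg hx.1 fun u _ => hr0 u)
  refine (hexp.dist_le_mul _ (hn x hx) _ (hn y hy)).trans ?_
  rw [NNReal.coe_one, one_mul, dist_neg_neg, Real.dist_eq,
    intervalIntegral.integral_interval_sub_left (hint _ _) (hint _ _), ← Real.norm_eq_abs]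
  refine (intervalIntegral.norm_integral_le_of_norm_le_const (C := K) fun u _ => ?_).trans ?_
  · rw [Real.norm_eq_abs, abs_of_nonneg (hr0 u)]
    exact hrK u
  · rw [Real.dist_eq]
    rfl

/-- Variation of constants for `-V' = k`, discounted at rate `r`. -/
theorem integral_exp_neg_integral_mul {r k V : ℝ → ℝ} {K s T : ℝ}
    (hr : Measurable r) (hr0 : ∀ t, 0 ≤ r t) (hrK : ∀ t, r t ≤ K) (hsT : s ≤ T)
    (hk : LocallyIntegrable k) (hV : ∀ t ∈ Set.Icc s T, V t = V T + ∫ u in t..T, k u) :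
    ∫ t in s..T, Real.exp (-∫ u in s..t, r u) * (r t * V t + k t) =
      V s - Real.exp (-∫ u in s..T, r u) * V T := by
  have hK : 0 ≤ K := (hr0 0).trans (hrK 0)
  have hrl : LocallyIntegrable r := (locallyIntegrable_const K).mono hr.aestronglyMeasurable
    (ae_of_all _ fun t => by simpa [abs_of_nonneg (hr0 t), abs_of_nonneg hK] using hrK t)
  have hE := absolutelyContinuousOnInterval_exp_neg_integral hr hr0 hrK hsT
  have hconst : AbsolutelyContinuousOnInterval (fun _ : ℝ => V T) s T :=
    (LipschitzWith.const (V T)).lipschitzOnWith.absolutelyContinuousOnInterval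
  have hkl : ∀ a b : ℝ, IntervalIntegrable k volume a b := fun a b =>
    (hk.integrableOn_isCompact isCompact_uIcc).intervalIntegrable
  have hg : AbsolutelyContinuousOnInterval (fun t => V T - ∫ u in T..t, k u) s T :=
    hconst.fun_sub ((hkl s T).absolutelyContinuousOnInterval_intervalIntegral
      Set.right_mem_uIcc)
  have hVg : ∀ t ∈ Set.Icc s T, V t = V T - ∫ u in T..t, k u := fun t ht => by
    rw [hV t ht, intervalIntegral.integral_symm T t, sub_eq_add_neg]
  have key := hE.integral_deriv_mul_eq_sub hg
  rw [← hVg T ⟨hsT, le_rfl⟩, ← hVg s ⟨le_rfl, hsT⟩, intervalIntegral.integral_same, neg_zero,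
    Real.exp_zero, one_mul] at key
  rw [← neg_sub, ← key, ← intervalIntegral.integral_neg]
  refine intervalIntegral.integral_congr_ae ?_
  filter_upwards [LocallyIntegrable.ae_hasDerivAt_integral hrl,
    LocallyIntegrable.ae_hasDerivAt_integral hk] with t h1 h2 ht
  rw [Set.uIoc_of_le hsT] at ht
  rw [(h1 s).fun_neg.exp.deriv, ((hasDerivAt_const t (V T)).fun_sub (h2 T)).deriv,
    ← hVg t ⟨ht.1.le, ht.2⟩]
  ring

/-- Up to time `T`, the functions `v l` are nonnegative and absolutely continuous, with derivative
`-k l`. -/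
structure IsPotential (T : ℝ) (v k : L → ℝ → ℝ) : Prop where
  continuous : ∀ l, Continuous (v l)
  nonneg : ∀ l, ∀ t ∈ Set.Icc 0 T, 0 ≤ v l t
  locallyIntegrable : ∀ l, LocallyIntegrable (k l)
  eq_add_integral : ∀ l, ∀ t ∈ Set.Icc 0 T, v l t = v l T + ∫ u in t..T, k l u

theorem IsPotential.measurable_ofReal {L : Type*} {T : ℝ} {v k : L → ℝ → ℝ}
    (h : IsPotential T v k) (l : L) :
    Measurable fun t => ENNReal.ofReal (v l t) :=
  ENNReal.measurable_ofReal.comp (h.continuous l).measurable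

namespace CTMDP

variable {L Act : Type*} [Fintype L] [Fintype Act] {M : CTMDP L Act}

/-- A positive upper bound of all exit rates. -/
def rateBound (M : CTMDP L Act) : ℝ≥0 := 1 + ∑ l, ∑ a, M.exitRate l a

theorem rateBound_pos (M : CTMDP L Act) : 0 < M.rateBound := by
  unfold rateBound
  positivity

theorem exitRate_le_rateBound (M : CTMDP L Act) (l : L) (a : Act) :
    M.exitRate l a ≤ M.rateBound :=
  (Finset.single_le_sum (f := fun a => M.exitRate l a) (fun _ _ => zero_le) (Finset.mem_univ a)).trans
    ((Finset.single_le_sum (f := fun l => ∑ a, M.exitRate l a) (fun _ _ => zero_le)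
      (Finset.mem_univ l)).trans le_add_self)

namespace Scheduler

variable {S : M.Scheduler}

theorem sum_prob_real (S : M.Scheduler) {n : ℕ} (π : TimedPath L Act n) (t : ℝ) :
    ∑ a, (S.prob π t a : ℝ) = 1 := by
  exact_mod_cast S.sum_prob π t

theorem totalRate_nonneg (S : M.Scheduler) {n : ℕ} (π : TimedPath L Act n) (t : ℝ) :
    0 ≤ S.totalRate π t :=
  Finset.sum_nonneg fun _ _ => by positivity

theorem totalRate_le (S : M.Scheduler) {n : ℕ} (π : TimedPath L Act n) (t : ℝ) :
    S.totalRate π t ≤ M.rateBound := by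
  calc S.totalRate π t ≤ ∑ a, (S.prob π t a : ℝ) * M.rateBound :=
        Finset.sum_le_sum fun a _ => mul_le_mul_of_nonneg_left
          (NNReal.coe_le_coe.2 (M.exitRate_le_rateBound _ a)) NNReal.zero_le_coe
    _ = M.rateBound := by rw [← Finset.sum_mul, sum_prob_real, one_mul]

theorem survival_le_one (S : M.Scheduler) {n : ℕ} (π : TimedPath L Act n) {t : ℝ}
    (ht : π.now ≤ t) : S.survival π t ≤ 1 := by
  rw [survival, ENNReal.ofReal_le_one, Real.exp_le_one_iff, neg_nonpos]
  exact intervalIntegral.integral_nonneg ht fun u _ => S.totalRate_nonneg π u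

/-- The expected rate of change of `v` caused by the transition out of `π.last` at time `t`. -/
def generator (S : M.Scheduler) (v : L → ℝ → ℝ) {n : ℕ} (π : TimedPath L Act n) (t : ℝ) : ℝ :=
  ∑ a, (S.prob π t a : ℝ) * ∑ l, (M.rate π.last a l : ℝ) * (v l t - v π.last t)

/-- The rate of transitions out of `π.last` at time `t`, weighted with `v` at the target. -/
def inflow (S : M.Scheduler) (v : L → ℝ → ℝ) {n : ℕ} (π : TimedPath L Act n) (t : ℝ) : ℝ :=
  ∑ a, (S.prob π t a : ℝ) * ∑ l, (M.rate π.last a l : ℝ) * v l t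

theorem generator_eq (S : M.Scheduler) (v : L → ℝ → ℝ) {n : ℕ} (π : TimedPath L Act n) (t : ℝ) :
    S.generator v π t = S.inflow v π t - S.totalRate π t * v π.last t := by
  simp only [generator, inflow, totalRate, exitRate, NNReal.coe_sum, mul_sub, Finset.sum_sub_distrib,
    Finset.sum_mul, Finset.mul_sum, mul_assoc]

/-- The expected weight `W` of the state after the next transition, if the last location of `π`
has just been entered and transitions after time `T` do not count. -/
def jumpValue (S : M.Scheduler) (T : ℝ) (W : L → ℝ → ℝ≥0∞) {n : ℕ} (π : TimedPath L Act n) :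
    ℝ≥0∞ :=
  ∫⁻ t in Set.Icc π.now T, S.survival π t *
    ∑ a, (S.prob π t a : ℝ≥0∞) * ∑ l, (M.rate π.last a l : ℝ≥0∞) * W l t

/-- The expected weight `W` of the state entered by the `n`-th transition. -/
def stepValue (S : M.Scheduler) (T : ℝ) (n : ℕ) (W : L → ℝ → ℝ≥0∞) : ℝ≥0∞ :=
  TimedPath.integral n fun π => S.stepDensity T π * W π.last π.now

/-- The expected weight `g` of the last location of the complete path, restricted to the paths with
exactly `n` transitions. -/
def stopValue (S : M.Scheduler) (T : ℝ) (n : ℕ) (g : L → ℝ≥0∞) : ℝ≥0∞ :=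
  TimedPath.integral n fun π => S.stepDensity T π * (S.survival π T * g π.last)

theorem stepValue_zero (S : M.Scheduler) (T : ℝ) (W : L → ℝ → ℝ≥0∞) :
    S.stepValue T 0 W = ∑ l, (M.init l : ℝ≥0∞) * W l 0 :=
  TimedPath.integral_zero _

theorem IsBorel.borelInTimes_stepValue (hS : S.IsBorel) (T : ℝ) (n : ℕ) {W : L → ℝ → ℝ≥0∞}
    (hW : ∀ l, Measurable (W l)) :
    TimedPath.BorelInTimes fun π : TimedPath L Act n => S.stepDensity T π * W π.last π.now :=
  fun loc act => (hS.borelInTimes_stepDensity T loc act).mul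
    ((hW (loc (Fin.last n))).comp (TimedPath.measurable_now loc act))

theorem IsBorel.borelInTimes_stopValue (hS : S.IsBorel) (T : ℝ) (n : ℕ) (g : L → ℝ≥0∞) :
    TimedPath.BorelInTimes fun π : TimedPath L Act n =>
      S.stepDensity T π * (S.survival π T * g π.last) :=
  fun loc act => (hS.borelInTimes_stepDensity T loc act).mul
    ((hS.borelInTimes_survival T loc act).mul_const (g (loc (Fin.last n))))

theorem IsBorel.stepValue_succ (hS : S.IsBorel) (T : ℝ) (n : ℕ) {W : L → ℝ → ℝ≥0∞}
    (hW : ∀ l, Measurable (W l)) :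
    S.stepValue T (n + 1) W =
      TimedPath.integral n fun π => S.stepDensity T π * S.jumpValue T W π := by
  rw [stepValue, TimedPath.integral_succ (hS.borelInTimes_stepValue T (n + 1) hW)]
  congr 1
  funext π
  have hm : ∀ l a, Measurable fun t => S.survival π t * (S.prob π t a : ℝ≥0∞) *
      (M.rate π.last a l : ℝ≥0∞) := fun l a =>
    ((hS.measurable_survival π).mul
      (measurable_coe_nnreal_ennreal.comp (hS.measurable_prob π a))).mul_const _
  have h : ∀ l a, ∫⁻ t, S.stepDensity T (π.snoc l a t) * W (π.snoc l a t).last (π.snoc l a t).now =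
      S.stepDensity T π * ∫⁻ t in Set.Icc π.now T,
        S.survival π t * (S.prob π t a : ℝ≥0∞) * (M.rate π.last a l : ℝ≥0∞) * W l t := by
    intro l a
    rw [← lintegral_indicator measurableSet_Icc, ← lintegral_const_mul]
    swap
    · exact ((hm l a).mul (hW l)).indicator measurableSet_Icc
    refine lintegral_congr fun t => ?_
    rw [stepDensity_snoc, TimedPath.last_snoc, TimedPath.now_snoc, mul_assoc]
    by_cases ht : t ∈ Set.Icc π.now T <;> simp [ht]
  simp only [h, ← Finset.mul_sum]
  congr 1
  rw [jumpValue]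
  have hsum : ∀ l, ∑ a, ∫⁻ t in Set.Icc π.now T,
      S.survival π t * (S.prob π t a : ℝ≥0∞) * (M.rate π.last a l : ℝ≥0∞) * W l t =
      ∫⁻ t in Set.Icc π.now T, ∑ a,
        S.survival π t * (S.prob π t a : ℝ≥0∞) * (M.rate π.last a l : ℝ≥0∞) * W l t := fun l =>
    (lintegral_finsetSum _ fun a _ => (hm l a).mul (hW l)).symm
  rw [Finset.sum_congr rfl fun l _ => hsum l, ← lintegral_finsetSum]
  swap
  · exact fun l _ => Finset.measurable_fun_sum _ fun a _ => (hm l a).mul (hW l)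
  refine lintegral_congr fun t => ?_
  rw [Finset.sum_comm, Finset.mul_sum]
  refine Finset.sum_congr rfl fun a _ => ?_
  simp only [Finset.mul_sum, mul_assoc]

section

variable {T : ℝ} {v k : L → ℝ → ℝ}

theorem inflow_nonneg (h : IsPotential T v k) {n : ℕ} (π : TimedPath L Act n) {t : ℝ}
    (ht : t ∈ Set.Icc 0 T) : 0 ≤ S.inflow v π t :=
  Finset.sum_nonneg fun _ _ => mul_nonneg NNReal.zero_le_coe <| Finset.sum_nonneg fun l _ =>
    mul_nonneg NNReal.zero_le_coe (h.nonneg l t ht)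

theorem IsBorel.intervalIntegrable_inflow (hS : S.IsBorel) (h : IsPotential T v k) {n : ℕ}
    (π : TimedPath L Act n) (hs : π.now ∈ Set.Icc 0 T) :
    IntervalIntegrable (fun t => Real.exp (-∫ u in π.now..t, S.totalRate π u) * S.inflow v π t)
      volume π.now T := by
  have hE := absolutelyContinuousOnInterval_exp_neg_integral (hS.measurable_totalRate π)
    (S.totalRate_nonneg π) (S.totalRate_le π) hs.2
  refine IntervalIntegrable.continuousOn_mul ?_ hE.continuousOn
  have hterm : ∀ a ∈ Finset.univ, IntervalIntegrable
      (fun t => (S.prob π t a : ℝ) * ∑ l, (M.rate π.last a l : ℝ) * v l t) volume π.now T := ?_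
  · convert! IntervalIntegrable.sum _ hterm using 1
    funext t
    simp [inflow]
  intro a _
  have hc : Continuous fun t => ∑ l, (M.rate π.last a l : ℝ) * v l t :=
    continuous_finsetSum _ fun l _ => (h.continuous l).const_mul _
  refine IntervalIntegrable.mul_continuousOn ?_ hc.continuousOn
  refine (intervalIntegrable_const (c := (1 : ℝ))).mono_fun
    (measurable_coe_nnreal_real.comp (hS.measurable_prob π a)).aestronglyMeasurable
    (ae_of_all _ fun t => ?_)
  have : S.prob π t a ≤ 1 := S.sum_prob π t ▸
    Finset.single_le_sum (f := fun a => S.prob π t a) (fun _ _ => zero_le) (Finset.mem_univ a)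
  simpa using this

theorem IsBorel.jumpValue_eq (hS : S.IsBorel) (h : IsPotential T v k) {n : ℕ}
    (π : TimedPath L Act n) (hs : π.now ∈ Set.Icc 0 T) :
    S.jumpValue T (fun l t => ENNReal.ofReal (v l t)) π = ENNReal.ofReal
      (∫ t in π.now..T, Real.exp (-∫ u in π.now..t, S.totalRate π u) * S.inflow v π t) := by
  have hint := hS.intervalIntegrable_inflow h π hs
  rw [intervalIntegral.integral_of_le hs.2, ← integral_Icc_eq_integral_Ioc,
    ofReal_integral_eq_lintegral_ofReal]
  · refine setLIntegral_congr_fun measurableSet_Icc fun t ht => ?_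
    have ht' : t ∈ Set.Icc 0 T := ⟨hs.1.trans ht.1, ht.2⟩
    simp only [survival]
    rw [ENNReal.ofReal_mul (Real.exp_pos _).le, inflow, ENNReal.ofReal_sum_of_nonneg fun a _ =>
      mul_nonneg NNReal.zero_le_coe <| Finset.sum_nonneg fun l _ =>
        mul_nonneg NNReal.zero_le_coe (h.nonneg l t ht')]
    congr 1
    refine Finset.sum_congr rfl fun a _ => ?_
    rw [ENNReal.ofReal_mul NNReal.zero_le_coe, ENNReal.ofReal_coe_nnreal,
      ENNReal.ofReal_sum_of_nonneg fun l _ => mul_nonneg NNReal.zero_le_coe (h.nonneg l t ht')]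
    congr 1
    refine Finset.sum_congr rfl fun l _ => ?_
    rw [ENNReal.ofReal_mul NNReal.zero_le_coe, ENNReal.ofReal_coe_nnreal]
  · exact (intervalIntegrable_iff_integrableOn_Icc_of_le hs.2).1 hint
  · refine (ae_restrict_iff' measurableSet_Icc).2 (ae_of_all _ fun t ht => ?_)
    exact mul_nonneg (Real.exp_pos _).le (inflow_nonneg h π ⟨hs.1.trans ht.1, ht.2⟩)

theorem IsBorel.survival_mul_add_jumpValue (hS : S.IsBorel) (h : IsPotential T v k) {n : ℕ}
    (π : TimedPath L Act n) (hs : π.now ∈ Set.Icc 0 T) :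
    S.survival π T * ENNReal.ofReal (v π.last T) +
        S.jumpValue T (fun l t => ENNReal.ofReal (v l t)) π =
      ENNReal.ofReal (v π.last π.now +
        ∫ t in π.now..T, Real.exp (-∫ u in π.now..t, S.totalRate π u) *
          (S.generator v π t - k π.last t)) := by
  have hT : T ∈ Set.Icc 0 T := ⟨hs.1.trans hs.2, le_rfl⟩
  have key := integral_exp_neg_integral_mul (hS.measurable_totalRate π) (S.totalRate_nonneg π)
    (S.totalRate_le π) hs.2 (h.locallyIntegrable π.last)
    fun t ht => h.eq_add_integral π.last t ⟨hs.1.trans ht.1, ht.2⟩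
  have hint := hS.intervalIntegrable_inflow h π hs
  have hE := absolutelyContinuousOnInterval_exp_neg_integral (hS.measurable_totalRate π)
    (S.totalRate_nonneg π) (S.totalRate_le π) hs.2
  have hint2 : IntervalIntegrable (fun t => Real.exp (-∫ u in π.now..t, S.totalRate π u) *
      (S.totalRate π t * v π.last t + k π.last t)) volume π.now T := by
    refine IntervalIntegrable.continuousOn_mul ?_ hE.continuousOn
    refine IntervalIntegrable.add ?_ 
      ((h.locallyIntegrable _).integrableOn_isCompact isCompact_uIcc).intervalIntegrable
    refine IntervalIntegrable.mul_continuousOn ?_ (h.continuous _).continuousOn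
    refine (intervalIntegrable_const (c := (M.rateBound : ℝ))).mono_fun
      (hS.measurable_totalRate π).aestronglyMeasurable (ae_of_all _ fun t => ?_)
    simpa [abs_of_nonneg (S.totalRate_nonneg π t)] using S.totalRate_le π t
  have hsub : ∫ t in π.now..T, Real.exp (-∫ u in π.now..t, S.totalRate π u) *
      (S.generator v π t - k π.last t) =
      (∫ t in π.now..T, Real.exp (-∫ u in π.now..t, S.totalRate π u) * S.inflow v π t) -
        (v π.last π.now - Real.exp (-∫ u in π.now..T, S.totalRate π u) * v π.last T) := by
    rw [← key, ← intervalIntegral.integral_sub hint hint2]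
    congr 1
    funext t
    rw [generator_eq]
    ring
  rw [hS.jumpValue_eq h π hs, survival, ← ENNReal.ofReal_mul (Real.exp_pos _).le,
    ← ENNReal.ofReal_add, hsub]
  · congr 1
    ring
  · exact mul_nonneg (Real.exp_pos _).le (h.nonneg _ _ hT)
  · exact intervalIntegral.integral_nonneg hs.2 fun t ht =>
      mul_nonneg (Real.exp_pos _).le (inflow_nonneg h π ⟨hs.1.trans ht.1, ht.2⟩)

end

theorem pathProb_eq (S : M.Scheduler) (T : ℝ) (A : {n : ℕ} → TimedPath L Act n → Prop) :
    S.pathProb T A = ∑' n, TimedPath.integral n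
      ({π : TimedPath L Act n | A π}.indicator fun π => S.stepDensity T π * S.survival π T) := by
  classical
  unfold pathProb TimedPath.integral
  refine tsum_congr fun n => Finset.sum_congr rfl fun loc _ => Finset.sum_congr rfl fun act _ =>
    lintegral_congr fun time => ?_
  rw [Set.indicator_apply]
  congr

/-- **Verification, upper bound.** If `v` decreases at least as fast as it is expected to grow by
transitions, and dominates the indicator function of `A` at time `T`, then it bounds the
probability of `A` at time `0`. -/
theorem IsBorel.pathProb_le (hS : S.IsBorel) {T : ℝ} (hT : 0 ≤ T)
    {A : {n : ℕ} → TimedPath L Act n → Prop} {v k : L → ℝ → ℝ} (h : IsPotential T v k)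
    (hgen : ∀ (n : ℕ) (π : TimedPath L Act n), S.stepDensity T π ≠ 0 →
      ∀ t ∈ Set.Icc 0 T, S.generator v π t ≤ k π.last t)
    (hA : ∀ (n : ℕ) (π : TimedPath L Act n), S.stepDensity T π ≠ 0 → A π → 1 ≤ v π.last T) :
    S.pathProb T A ≤ ∑ l, (M.init l : ℝ≥0∞) * ENNReal.ofReal (v l 0) := by
  set W : L → ℝ → ℝ≥0∞ := fun l t => ENNReal.ofReal (v l t) with hW
  have hWm := h.measurable_ofReal
  have step : ∀ n, S.stopValue T n (fun l => W l T) + S.stepValue T (n + 1) W ≤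
      S.stepValue T n W := by
    intro n
    rw [hS.stepValue_succ T n hWm, stopValue, ← TimedPath.integral_add
      (hS.borelInTimes_stopValue T n fun l => W l T)]
    refine TimedPath.integral_mono fun π => ?_
    rcases eq_or_ne (S.stepDensity T π) 0 with h0 | h0
    · simp [h0]
    have hs := now_mem_of_stepDensity_ne_zero hT h0
    rw [← mul_add, hS.survival_mul_add_jumpValue h π hs]
    gcongr
    refine ENNReal.ofReal_le_ofReal (add_le_of_nonpos_right ?_)
    rw [← neg_nonneg, ← intervalIntegral.integral_neg]
    refine intervalIntegral.integral_nonneg hs.2 fun t ht => ?_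
    rw [← mul_neg, neg_sub]
    exact mul_nonneg (Real.exp_pos _).le
      (sub_nonneg.2 (hgen n π h0 t ⟨hs.1.trans ht.1, ht.2⟩))
  have sum : ∀ n, ∑ i ∈ Finset.range n, S.stopValue T i (fun l => W l T) + S.stepValue T n W ≤
      S.stepValue T 0 W := by
    intro n
    induction n with
    | zero => simp
    | succ n ih =>
      rw [Finset.sum_range_succ, add_assoc]
      exact (add_le_add_right (step n) _).trans ih
  rw [pathProb_eq, ← stepValue_zero S T W]
  refine ENNReal.tsum_le_of_sum_range_le fun n => le_trans (Finset.sum_le_sum fun i _ => ?_)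
    (le_self_add.trans (sum n))
  refine TimedPath.integral_mono fun π => Set.indicator_apply_le' (fun hπ => ?_) fun _ => zero_le
  rcases eq_or_ne (S.stepDensity T π) 0 with h0 | h0
  · simp [h0]
  gcongr
  refine le_mul_of_one_le_right' ?_
  rw [hW]
  exact ENNReal.one_le_ofReal.2 (hA i π h0 hπ)

/-- There are no explosions: the probability that the `n`-th transition takes place before time `T`
tends to `0`. -/
theorem IsBorel.tendsto_stepValue_one (hS : S.IsBorel) {T : ℝ} (hT : 0 ≤ T) :
    Tendsto (fun n => S.stepValue T n fun _ _ => 1) atTop (𝓝 0) := by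
  set c : ℝ := (M.rateBound : ℝ) with hc
  have hc0 : 0 < c := NNReal.coe_pos.2 M.rateBound_pos
  -- The weight `exp (-2ct)` of the transition times is halved by each transition.
  set W : L → ℝ → ℝ≥0∞ := fun _ t => ENNReal.ofReal (Real.exp (-(2 * c * t))) with hW
  have hWm : ∀ l, Measurable (W l) := fun l => by
    refine ENNReal.measurable_ofReal.comp (Continuous.measurable ?_)
    fun_prop
  have step : ∀ n, S.stepValue T (n + 1) W ≤ 2⁻¹ * S.stepValue T n W := by
    intro n
    rw [hS.stepValue_succ T n hWm, stepValue,
      ← TimedPath.integral_const_mul _ (hS.borelInTimes_stepValue T n hWm)]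
    refine TimedPath.integral_mono fun π => ?_
    rcases eq_or_ne (S.stepDensity T π) 0 with h0 | h0
    · simp [h0]
    have hs := now_mem_of_stepDensity_ne_zero hT h0
    rw [mul_left_comm]
    gcongr
    have hd : ∀ t, HasDerivAt (fun t => -(2⁻¹ * Real.exp (-(2 * c * t))))
        (c * Real.exp (-(2 * c * t))) t := by
      intro t
      have := ((((hasDerivAt_id t).const_mul (2 * c)).fun_neg.exp).const_mul 2⁻¹).neg
      convert! this using 1
      simp only [id, mul_one]
      ring
    have hcont : Continuous fun t : ℝ => c * Real.exp (-(2 * c * t)) := by fun_prop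
    calc S.jumpValue T W π ≤ ∫⁻ t in Set.Icc π.now T,
          ENNReal.ofReal (c * Real.exp (-(2 * c * t))) := by
          refine setLIntegral_mono' measurableSet_Icc fun t ht => ?_
          have h1 : ∑ a, (S.prob π t a : ℝ≥0∞) * ∑ l, (M.rate π.last a l : ℝ≥0∞) * W l t =
              ENNReal.ofReal (S.totalRate π t) * ENNReal.ofReal (Real.exp (-(2 * c * t))) := by
            rw [totalRate, ENNReal.ofReal_sum_of_nonneg fun a _ => by positivity, Finset.sum_mul]
            refine Finset.sum_congr rfl fun a _ => ?_
            rw [ENNReal.ofReal_mul NNReal.zero_le_coe, ENNReal.ofReal_coe_nnreal,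
              ENNReal.ofReal_coe_nnreal, hW, ← Finset.sum_mul, exitRate, ENNReal.ofNNReal_finsetSum, ← mul_assoc]
          rw [h1, ENNReal.ofReal_mul hc0.le]
          calc _ ≤ 1 * (ENNReal.ofReal (S.totalRate π t) *
                ENNReal.ofReal (Real.exp (-(2 * c * t)))) := by
                gcongr
                exact S.survival_le_one π ht.1
            _ ≤ _ := by
                rw [one_mul]
                gcongr
                exact S.totalRate_le π t
      _ = ENNReal.ofReal (∫ t in π.now..T, c * Real.exp (-(2 * c * t))) := by
          rw [intervalIntegral.integral_of_le hs.2, ← integral_Icc_eq_integral_Ioc,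
            ofReal_integral_eq_lintegral_ofReal hcont.continuousOn.integrableOn_Icc]
          exact ae_of_all _ fun t => by positivity
      _ ≤ ENNReal.ofReal (2⁻¹ * Real.exp (-(2 * c * π.now))) := by
          rw [intervalIntegral.integral_eq_sub_of_hasDerivAt (fun t _ => hd t)
            (hcont.intervalIntegrable _ _)]
          refine ENNReal.ofReal_le_ofReal ?_
          have := Real.exp_pos (-(2 * c * T))
          linarith
      _ = 2⁻¹ * W π.last π.now := by
          rw [ENNReal.ofReal_mul (by norm_num), ENNReal.ofReal_inv_of_pos (by norm_num)]
          simp [hW]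
  have pow : ∀ n, S.stepValue T n W ≤ 2⁻¹ ^ n := by
    intro n
    induction n with
    | zero =>
      rw [stepValue_zero]
      simp [hW, ← ENNReal.ofNNReal_finsetSum, M.sum_init]
    | succ n ih =>
      rw [pow_succ']
      exact (step n).trans (by gcongr)
  have bound : ∀ n, S.stepValue T n (fun _ _ => 1) ≤
      ENNReal.ofReal (Real.exp (2 * c * T)) * 2⁻¹ ^ n := by
    intro n
    refine le_trans ?_ (mul_le_mul_right (pow n) _)
    rw [stepValue, stepValue,
      ← TimedPath.integral_const_mul _ (hS.borelInTimes_stepValue T n hWm)]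
    refine TimedPath.integral_mono fun π => ?_
    rcases eq_or_ne (S.stepDensity T π) 0 with h0 | h0
    · simp [h0]
    have hs := now_mem_of_stepDensity_ne_zero hT h0
    rw [mul_left_comm]
    gcongr
    rw [hW, ← ENNReal.ofReal_mul (Real.exp_pos _).le, ← Real.exp_add, ENNReal.one_le_ofReal,
      Real.one_le_exp_iff]
    nlinarith [hs.2]
  refine tendsto_of_tendsto_of_tendsto_of_le_of_le tendsto_const_nhds ?_ (fun _ => zero_le) bound
  have := ENNReal.Tendsto.const_mul (a := ENNReal.ofReal (Real.exp (2 * c * T)))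
    (ENNReal.tendsto_pow_atTop_nhds_zero_of_lt_one (r := 2⁻¹) (by norm_num))
    (Or.inr ENNReal.ofReal_ne_top)
  simpa using this

/-- **Verification, lower bound.** If `v` is bounded by `1`, decreases at most as fast as it is
expected to grow by transitions, and is dominated by the indicator function of `A` at time `T`,
then it is a lower bound of the probability of `A` at time `0`. -/
theorem IsBorel.le_pathProb (hS : S.IsBorel) {T : ℝ} (hT : 0 ≤ T)
    {A : {n : ℕ} → TimedPath L Act n → Prop} {v k : L → ℝ → ℝ} (h : IsPotential T v k)
    (hv1 : ∀ l, ∀ t ∈ Set.Icc 0 T, v l t ≤ 1)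
    (hgen : ∀ (n : ℕ) (π : TimedPath L Act n), S.stepDensity T π ≠ 0 →
      ∀ t ∈ Set.Icc 0 T, k π.last t ≤ S.generator v π t)
    (hA : ∀ (n : ℕ) (π : TimedPath L Act n), S.stepDensity T π ≠ 0 → ¬ A π → v π.last T ≤ 0) :
    ∑ l, (M.init l : ℝ≥0∞) * ENNReal.ofReal (v l 0) ≤ S.pathProb T A := by
  set W : L → ℝ → ℝ≥0∞ := fun l t => ENNReal.ofReal (v l t) with hW
  have hWm := h.measurable_ofReal
  have step : ∀ n, S.stepValue T n W ≤
      S.stopValue T n (fun l => W l T) + S.stepValue T (n + 1) W := by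
    intro n
    rw [hS.stepValue_succ T n hWm, stopValue, ← TimedPath.integral_add
      (hS.borelInTimes_stopValue T n fun l => W l T)]
    refine TimedPath.integral_mono fun π => ?_
    rcases eq_or_ne (S.stepDensity T π) 0 with h0 | h0
    · simp [h0]
    have hs := now_mem_of_stepDensity_ne_zero hT h0
    rw [← mul_add, hS.survival_mul_add_jumpValue h π hs]
    gcongr
    refine ENNReal.ofReal_le_ofReal (le_add_of_nonneg_right ?_)
    exact intervalIntegral.integral_nonneg hs.2 fun t ht => mul_nonneg (Real.exp_pos _).le
      (sub_nonneg.2 (hgen n π h0 t ⟨hs.1.trans ht.1, ht.2⟩))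
  have sum : ∀ n, S.stepValue T 0 W ≤
      ∑ i ∈ Finset.range n, S.stopValue T i (fun l => W l T) + S.stepValue T n W := by
    intro n
    induction n with
    | zero => simp
    | succ n ih =>
      rw [Finset.sum_range_succ, add_assoc]
      exact ih.trans (add_le_add_right (step n) _)
  have term_le : ∀ n, S.stopValue T n (fun l => W l T) ≤ TimedPath.integral n
      ({π : TimedPath L Act n | A π}.indicator fun π => S.stepDensity T π * S.survival π T) := by
    intro n
    refine TimedPath.integral_mono fun π => ?_
    rcases eq_or_ne (S.stepDensity T π) 0 with h0 | h0
    · simp [h0]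
    have hs := now_mem_of_stepDensity_ne_zero hT h0
    by_cases hπ : A π
    · rw [Set.indicator_of_mem (by exact hπ)]
      gcongr
      refine mul_le_of_le_one_right' ?_
      exact ENNReal.ofReal_le_one.2 (hv1 _ _ ⟨hT, le_rfl⟩)
    · rw [hW]
      simp [ENNReal.ofReal_of_nonpos (hA n π h0 hπ)]
  have le : ∀ n, S.stepValue T n W ≤ S.stepValue T n fun _ _ => 1 := by
    intro n
    refine TimedPath.integral_mono fun π => ?_
    rcases eq_or_ne (S.stepDensity T π) 0 with h0 | h0
    · simp [h0]
    gcongr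
    exact ENNReal.ofReal_le_one.2 (hv1 _ _ (now_mem_of_stepDensity_ne_zero hT h0))
  rw [← stepValue_zero S T W, pathProb_eq]
  have lim := (hS.tendsto_stepValue_one hT).const_add (∑' n, TimedPath.integral n
    ({π : TimedPath L Act n | A π}.indicator fun π => S.stepDensity T π * S.survival π T))
  rw [add_zero] at lim
  refine ge_of_tendsto' lim fun n => (sum n).trans (add_le_add ?_ (le n))
  exact (Finset.sum_le_sum fun i _ => term_le i).trans (ENNReal.sum_le_tsum _)

end Scheduler

end CTMDP

/-! ### The Bellman equation -/

/-- The projection to the unit cube. -/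
def cubeProj {L : Type*} (x : L → ℝ) (l : L) : ℝ := max 0 (min 1 (x l))

theorem cubeProj_mem {L : Type*} (x : L → ℝ) (l : L) : cubeProj x l ∈ Set.Icc 0 1 :=
  ⟨le_max_left _ _, max_le zero_le_one (min_le_left _ _)⟩

theorem lipschitzWith_cubeProj {L : Type*} [Fintype L] :
    LipschitzWith 1 (cubeProj : (L → ℝ) → L → ℝ) := by
  refine LipschitzWith.of_dist_le_mul fun x y => (dist_pi_le_iff (by positivity)).2 fun l => ?_
  exact (((LipschitzWith.eval (α := fun _ : L => ℝ) l).const_min 1).const_max 0).dist_le_mul x y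

/-- A function that cannot increase where it exceeds `1` stays at most `1`. -/
theorem le_one_of_deriv_nonpos {f f' : ℝ → ℝ} {T : ℝ}
    (hf : ∀ t ∈ Set.Icc 0 T, HasDerivWithinAt f (f' t) (Set.Icc 0 T) t) (h0 : f 0 ≤ 1)
    (hf' : ∀ t ∈ Set.Icc 0 T, 1 < f t → f' t ≤ 0) : ∀ t ∈ Set.Icc 0 T, f t ≤ 1 := by
  intro t ht
  refine le_of_forall_pos_le_add fun ε hε => ?_
  have hT : 0 ≤ T := ht.1.trans ht.2
  -- Compare `f` with a barrier of small positive slope.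
  set δ := ε / (1 + T) with hδ
  have hδ0 : 0 < δ := by positivity
  have h := image_le_of_deriv_right_lt_deriv_boundary (f := f) (f' := f') (a := 0) (b := T)
    (B := fun t => 1 + δ * (1 + t)) (B' := fun _ => δ)
    (fun t ht => (hf t ht).continuousWithinAt)
    (fun t ht => (hf t ⟨ht.1, ht.2.le⟩).mono_of_mem_nhdsWithin (Icc_mem_nhdsGE_of_mem ht))
    (by simp only [add_zero, mul_one]; linarith)
    (fun t => by simpa using (((hasDerivAt_id t).const_add 1).const_mul δ).const_add 1)
    (fun t ht heq => lt_of_le_of_lt (hf' t ⟨ht.1, ht.2.le⟩ (by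
      rw [heq]
      have := mul_pos hδ0 (by linarith [ht.1] : 0 < 1 + t)
      linarith)) hδ0) ht
  refine h.trans (add_le_add_right ?_ _)
  calc δ * (1 + t) ≤ δ * (1 + T) := by gcongr; exact ht.2
    _ = ε := by rw [hδ]; field_simp

namespace CTMDP

variable {L Act : Type*} [Fintype L] [Fintype Act]

/-- The expected rate of change of `x` under the transitions of the action `a` in `l`. -/
def drift (M : CTMDP L Act) (x : L → ℝ) (l : L) (a : Act) : ℝ :=
  ∑ l', (M.rate l a l' : ℝ) * (x l' - x l)

open Classical in
/-- The finite set of the actions enabled in `l`. -/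
def enabledActions (M : CTMDP L Act) (l : L) : Finset Act := Finset.univ.filter (M.Enabled l)

theorem mem_enabledActions {M : CTMDP L Act} {l : L} {a : Act} :
    a ∈ M.enabledActions l ↔ M.Enabled l a := by
  simp [enabledActions]

theorem enabledActions_nonempty (M : CTMDP L Act) (l : L) : (M.enabledActions l).Nonempty :=
  (M.exists_enabled l).imp fun _ h => mem_enabledActions.2 h

/-- The least drift of `x` over all enabled actions: the right-hand side of the Bellman equation
for minimum reachability. -/
def minDrift (M : CTMDP L Act) (x : L → ℝ) (l : L) : ℝ :=
  (M.enabledActions l).inf' (M.enabledActions_nonempty l) (M.drift x l)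

variable {M : CTMDP L Act}

theorem minDrift_le (x : L → ℝ) {l : L} {a : Act} (ha : M.Enabled l a) :
    M.minDrift x l ≤ M.drift x l a :=
  Finset.inf'_le _ (mem_enabledActions.2 ha)

theorem exists_drift_eq_minDrift (M : CTMDP L Act) (x : L → ℝ) (l : L) :
    ∃ a, M.Enabled l a ∧ M.drift x l a = M.minDrift x l := by
  obtain ⟨a, ha, h⟩ := Finset.exists_mem_eq_inf' (M.enabledActions_nonempty l) (M.drift x l)
  exact ⟨a, mem_enabledActions.1 ha, h.symm⟩

theorem drift_le_add (x y : L → ℝ) (l : L) (a : Act) :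
    M.drift x l a ≤ M.drift y l a + 2 * M.rateBound * dist x y := by
  have h : M.drift x l a ≤ M.drift y l a + ∑ l', (M.rate l a l' : ℝ) * (2 * dist x y) := by
    rw [drift, drift, ← Finset.sum_add_distrib]
    refine Finset.sum_le_sum fun l' _ => ?_
    rw [← mul_add]
    refine mul_le_mul_of_nonneg_left ?_ NNReal.zero_le_coe
    have h1 := (le_abs_self _).trans (dist_le_pi_dist x y l')
    have h2 := (neg_le_abs _).trans (dist_le_pi_dist x y l)
    linarith
  refine h.trans (add_le_add_right ?_ _)
  rw [← Finset.sum_mul, ← NNReal.coe_sum]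
  have h3 : ((∑ l', M.rate l a l' : ℝ≥0) : ℝ) ≤ M.rateBound := M.exitRate_le_rateBound l a
  have := mul_le_mul_of_nonneg_right h3 (by positivity : 0 ≤ 2 * dist x y)
  linarith

theorem lipschitzWith_minDrift (M : CTMDP L Act) : LipschitzWith (2 * M.rateBound) M.minDrift := by
  have h : ∀ l, LipschitzWith (2 * M.rateBound) fun x => M.minDrift x l := by
    refine fun l => LipschitzWith.of_le_add_mul _ fun x y => ?_
    obtain ⟨a, ha, h⟩ := M.exists_drift_eq_minDrift y l
    rw [← h]
    exact (minDrift_le x ha).trans (drift_le_add x y l a)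
  refine LipschitzWith.of_dist_le_mul fun x y => ?_
  exact (dist_pi_le_iff (by positivity)).2 fun l => (h l).dist_le_mul x y

theorem minDrift_zero (M : CTMDP L Act) : M.minDrift 0 = 0 := by
  funext l
  obtain ⟨a, -, h⟩ := M.exists_drift_eq_minDrift 0 l
  rw [← h]
  simp [drift]

theorem minDrift_nonpos {x : L → ℝ} {l : L} (h : ∀ l', x l' ≤ x l) : M.minDrift x l ≤ 0 := by
  obtain ⟨a, -, h'⟩ := M.exists_drift_eq_minDrift x l
  rw [← h']
  exact Finset.sum_nonpos fun l' _ =>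
    mul_nonpos_of_nonneg_of_nonpos NNReal.zero_le_coe (sub_nonpos.2 (h l'))

theorem minDrift_nonneg {x : L → ℝ} {l : L} (h : ∀ l', x l ≤ x l') : 0 ≤ M.minDrift x l := by
  obtain ⟨a, -, h'⟩ := M.exists_drift_eq_minDrift x l
  rw [← h']
  exact Finset.sum_nonneg fun l' _ => mul_nonneg NNReal.zero_le_coe (sub_nonneg.2 (h l'))

open Classical in
/-- The Bellman equation for minimum reachability has a solution on `[0,T]` with values in the unit
interval. -/
theorem exists_bellman_solution (M : CTMDP L Act) {T : ℝ} (hT : 0 ≤ T) :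
    ∃ v : L → ℝ → ℝ, (∀ l, Continuous (v l)) ∧ (∀ l t, v l t ∈ Set.Icc 0 1) ∧
      (∀ l, v l T = if l ∈ M.goal then 1 else 0) ∧
      ∀ l, ∀ t ∈ Set.Icc 0 T, v l t = v l T + ∫ u in t..T, M.minDrift (fun l => v l u) l := by
  set x₀ : L → ℝ := fun l => if l ∈ M.goal then 1 else 0 with hx₀
  -- The vector field is made bounded by a projection to the unit cube. The solution of the
  -- modified equation stays in the cube, so that it solves the original equation.
  set F : (L → ℝ) → L → ℝ := fun x => M.minDrift (cubeProj x) with hF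
  have hFl : LipschitzWith (2 * M.rateBound) F := by
    have h := (lipschitzWith_minDrift M).comp (lipschitzWith_cubeProj (L := L))
    rwa [mul_one] at h
  have hFb : ∀ x, ‖F x‖ ≤ (2 * M.rateBound : ℝ≥0) := by
    intro x
    have h := (lipschitzWith_minDrift M).dist_le_mul (cubeProj x) 0
    rw [minDrift_zero, dist_zero_right, dist_zero_right] at h
    refine h.trans (mul_le_of_le_one_right NNReal.zero_le_coe ?_)
    refine (pi_norm_le_iff_of_nonneg zero_le_one).2 fun l => ?_
    rw [Real.norm_eq_abs, abs_of_nonneg (cubeProj_mem x l).1]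
    exact (cubeProj_mem x l).2
  have hPL : IsPicardLindelof (fun _ => F) (tmin := 0) (tmax := T) ⟨0, le_rfl, hT⟩ x₀
      (2 * M.rateBound * T.toNNReal) 0 (2 * M.rateBound) (2 * M.rateBound) :=
    IsPicardLindelof.of_time_independent (fun x _ => hFb x) hFl.lipschitzOnWith (by
      simp [hT])
  obtain ⟨y, hy0, hy⟩ := hPL.exists_eq_forall_mem_Icc_hasDerivWithinAt₀
  simp only at hy0
  have hyl : ∀ l, ∀ t ∈ Set.Icc 0 T,
      HasDerivWithinAt (fun t => y t l) (F (y t) l) (Set.Icc 0 T) t := fun l t ht =>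
    hasDerivWithinAt_pi.1 (hy t ht) l
  have hy1 : ∀ l, ∀ t ∈ Set.Icc 0 T, y t l ≤ 1 := by
    intro l
    refine le_one_of_deriv_nonpos (hyl l) ?_ fun t ht h => minDrift_nonpos fun l' => ?_
    · rw [hy0, hx₀]
      dsimp only
      split_ifs <;> norm_num
    · refine (cubeProj_mem _ _).2.trans (le_of_eq ?_)
      simp [cubeProj, min_eq_left h.le]
  have hy2 : ∀ l, ∀ t ∈ Set.Icc 0 T, 0 ≤ y t l := by
    intro l t ht
    have h := le_one_of_deriv_nonpos (f := fun t => 1 - y t l)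
      (fun t ht => (hyl l t ht).const_sub 1) ?_ (fun t ht h => neg_nonpos.2 ?_) t ht
    · linarith
    · rw [hy0, hx₀]
      dsimp only
      split_ifs <;> norm_num
    · refine minDrift_nonneg fun l' => le_trans (le_of_eq ?_) (cubeProj_mem _ _).1
      simp [cubeProj, (by linarith : y t l ≤ 0)]
  have hclamp : ∀ t ∈ Set.Icc 0 T, cubeProj (y t) = y t := by
    intro t ht
    funext l
    simp [cubeProj, hy1 l t ht, hy2 l t ht]
  have hyc : ContinuousOn y (Set.Icc 0 T) := fun t ht => (hy t ht).continuousWithinAt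
  have hYc : Continuous (Set.IccExtend hT (Set.domRestrict (Set.Icc 0 T) y)) :=
    hyc.domRestrict.Icc_extend'
  have hproj : ∀ t, ∃ s ∈ Set.Icc 0 T,
      Set.IccExtend hT (Set.domRestrict (Set.Icc 0 T) y) t = y s := fun t =>
    ⟨_, (Set.projIcc 0 T hT t).2, rfl⟩
  have hY : ∀ t ∈ Set.Icc 0 T, Set.IccExtend hT (Set.domRestrict (Set.Icc 0 T) y) t = y t := by
    intro t ht
    rw [Set.IccExtend_of_mem _ _ ht]
    rfl
  generalize Set.IccExtend hT (Set.domRestrict (Set.Icc 0 T) y) = Y at hYc hproj hY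
  have hmem : ∀ t ∈ Set.Icc 0 T, T - t ∈ Set.Icc 0 T := fun t ht =>
    ⟨sub_nonneg.2 ht.2, sub_le_self _ ht.1⟩
  refine ⟨fun l t => Y (T - t) l, fun l => ?_, fun l t => ?_, fun l => ?_, fun l t ht => ?_⟩
  · exact (continuous_apply l).comp (hYc.comp (continuous_const.sub continuous_id))
  · obtain ⟨s, hs, h⟩ := hproj (T - t)
    dsimp only
    rw [h]
    exact ⟨hy2 l s hs, hy1 l s hs⟩
  · dsimp only
    rw [sub_self, hY 0 ⟨le_rfl, hT⟩, hy0]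
  · have hc : Continuous fun u => M.minDrift (Y u) l :=
      (continuous_apply l).comp ((lipschitzWith_minDrift M).continuous.comp hYc)
    have hT' := hmem t ht
    have hftc := intervalIntegral.integral_eq_sub_of_hasDeriv_right_of_le (f := fun t => y t l)
      (f' := fun u => M.minDrift (Y u) l) hT'.1
      (fun s hs => ((hyl l s ⟨hs.1, hs.2.trans hT'.2⟩).continuousWithinAt).mono
        (Set.Icc_subset_Icc le_rfl hT'.2))
      (fun s hs => by
        have hs' : s ∈ Set.Icc 0 T := ⟨hs.1.le, hs.2.le.trans hT'.2⟩
        have h := hyl l s hs'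
        rw [hF] at h
        dsimp only at h
        rw [hclamp s hs', ← hY s hs'] at h
        exact (h.mono_of_mem_nhdsWithin (Icc_mem_nhdsGE_of_mem
          ⟨hs.1.le, hs.2.trans_le hT'.2⟩)).mono Set.Ioi_subset_Ici_self)
      (hc.intervalIntegrable _ _)
    have hsub := intervalIntegral.integral_comp_sub_left (a := t) (b := T)
      (fun u => M.minDrift (Y u) l) T
    rw [sub_self] at hsub
    simp only [sub_self]
    change Y (T - t) l = Y 0 l + ∫ u in t..T, M.minDrift (Y (T - u)) l
    rw [hY _ hT', hY 0 ⟨le_rfl, hT⟩, hsub, hftc]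
    ring

end CTMDP

/-! ### The difference measure and cylindrical approximation -/

namespace TimedPath

variable {L Act : Type*}

theorem snoc_dropLast {n : ℕ} (π : TimedPath L Act (n + 1)) :
    π.dropLast.snoc π.last (π.act (Fin.last n)) π.now = π := by
  obtain ⟨loc, act, time⟩ := π
  simp only [snoc, dropLast, last, now, mk.injEq]
  exact ⟨Fin.snoc_init_self loc, Fin.snoc_init_self act, Fin.snoc_init_self time⟩

theorem lift_injective {n : ℕ} :
    Function.Injective (lift : TimedPath L Act n → _) := by
  rintro ⟨loc, act, time⟩ ⟨loc', act', time'⟩ h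
  simp only [lift, mk.injEq, funext_iff, Option.some.injEq, Sum.inl.injEq] at h
  simp only [mk.injEq, funext_iff]
  exact h

theorem lift_snoc {n : ℕ} (π : TimedPath L Act n) (l : L) (a : Act) (t : ℝ) :
    (π.snoc l a t).lift = π.lift.snoc (some l) (some (Sum.inl a)) t := by
  simp only [lift, snoc, mk.injEq, and_true]
  constructor <;> funext i <;> induction i using Fin.lastCases <;> simp

end TimedPath

/-- The potential used to bound the difference measure: the fresh location `none` has value `1`, and
an old location has the maximal expected number of transitions to the fresh location in the
remaining time, if these occur at rate at most `c` and only at times in `D`. -/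
theorem isPotential_diff {L : Type*} {T : ℝ} {D : Set ℝ} (hD : MeasurableSet D)
    {c : ℝ} (hc : 0 ≤ c) :
    IsPotential (L := Option L) T
      (fun l t => l.elim 1 fun _ => ∫ u in t..T, D.indicator (fun _ => c) u)
      (fun l => l.elim (fun _ => 0) fun _ => D.indicator fun _ => c) := by
  have hl : LocallyIntegrable (D.indicator fun _ => c) :=
    (locallyIntegrable_const c).indicator hD
  have hi : ∀ a b : ℝ, IntervalIntegrable (D.indicator fun _ => c) volume a b := fun a b =>
    (hl.integrableOn_isCompact isCompact_uIcc).intervalIntegrable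
  refine ⟨?_, ?_, ?_, ?_⟩ <;> rintro (_ | l)
  · exact continuous_const
  · simp only [Option.elim]
    simp_rw [intervalIntegral.integral_symm T]
    exact (intervalIntegral.continuous_primitive hi T).neg
  · exact fun t _ => zero_le_one
  · exact fun t ht => intervalIntegral.integral_nonneg ht.2 fun u _ =>
      Set.indicator_nonneg (fun _ _ => hc) u
  · exact locallyIntegrable_const 0
  · exact hl
  · simp
  · simp

namespace CTMDP

variable {L Act : Type*} [Fintype L] [Fintype Act] {M : CTMDP L Act}

/-- Every set of subsets of a finite type is measurable, so a family of sets that is measurable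
elementwise can be composed with an arbitrary selection function. -/
theorem measurableSet_setOf_selection {Z β : Type*} [MeasurableSpace Z] {A : Z → Set Act}
    (hA : ∀ a, MeasurableSet {z | a ∈ A z}) (g : Set Act → β) (b : β) :
    MeasurableSet {z | g (A z) = b} :=
  (measurable_set_iff.2 fun a => measurable_mem.2 (hA a)) (Set.toFinite {s | g s = b}).measurableSet

open Classical in
theorem pick_congr (l : L) {p q p' q' : Act → ℝ≥0} (h : ∀ a, q a < p a ↔ q' a < p' a) :
    M.pick l p q = M.pick l p' q' := by
  have h' : (Finset.univ.filter fun a => q a < p a) = Finset.univ.filter fun a => q' a < p' a :=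
    Finset.filter_congr fun a _ => h a
  unfold pick
  simp only [h']

theorem measurableSet_pick_eq {Z : Type*} [MeasurableSpace Z] (l : L) {p q : Z → Act → ℝ≥0}
    (hp : ∀ a, Measurable fun z => p z a) (hq : ∀ a, Measurable fun z => q z a) (b : Act) :
    MeasurableSet {z | M.pick l (p z) (q z) = b} := by
  classical
  have h : ∀ z, M.pick l (p z) (q z) =
      M.pick l (Set.indicator {a | q z a < p z a} 1) 0 := fun z => pick_congr l fun a => by
    by_cases h : q z a < p z a <;> simp [h]
  simp only [h]
  exact measurableSet_setOf_selection (A := fun z => {a | q z a < p z a})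
    (fun a => measurableSet_lt (hq a) (hp a)) (fun s => M.pick l (Set.indicator s 1) 0) b

theorem measurable_diffDecision {Z : Type*} [MeasurableSpace Z] (l : L) {p q : Z → Act → ℝ≥0}
    (hp : ∀ a, Measurable fun z => p z a) (hq : ∀ a, Measurable fun z => q z a)
    (x : Option (Act ⊕ Act × Act)) : Measurable fun z => M.diffDecision l (p z) (q z) x := by
  classical
  rcases x with _ | (a | ⟨a, b⟩)
  · exact measurable_const
  · exact (hp a).min (hq a)
  · simp only [diffDecision, Prod.mk.injEq]
    refine Measurable.ite ?_ ?_ measurable_const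
    · have h := (measurableSet_pick_eq (M := M) l hp hq a).inter
        (measurableSet_pick_eq (M := M) l hq hp b)
      convert h using 1
      ext z
      simp [eq_comm]
    · exact measurable_const.sub (Finset.measurable_fun_sum _ fun a _ => (hp a).min (hq a))

namespace Scheduler

theorem diffScheduler_prob_lift (D E : M.Scheduler) {n : ℕ} (π : TimedPath L Act n) (t : ℝ)
    (x : Option (Act ⊕ Act × Act)) :
    (D.diffScheduler E).prob π.lift t x =
      M.diffDecision π.last (D.prob π t) (E.prob π t) x := by
  have h : ∃ π₀ : TimedPath L Act n, π₀.lift = π.lift := ⟨π, rfl⟩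
  have hc : h.choose = π := TimedPath.lift_injective h.choose_spec
  simp only [diffScheduler, h, dite_true, hc]

theorem IsBorel.diffScheduler {D E : M.Scheduler} (hD : D.IsBorel) (hE : E.IsBorel) :
    (D.diffScheduler E).IsBorel := by
  classical
  intro n loc act x
  by_cases h : ∃ π₀ : TimedPath L Act n, π₀.lift.loc = loc ∧ π₀.lift.act = act
  · obtain ⟨π₀, rfl, rfl⟩ := h
    have h : ∀ p : (Fin n → ℝ) × ℝ,
        (D.diffScheduler E).prob ⟨π₀.lift.loc, π₀.lift.act, p.1⟩ p.2 x =
          M.diffDecision π₀.last (D.prob ⟨π₀.loc, π₀.act, p.1⟩ p.2)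
            (E.prob ⟨π₀.loc, π₀.act, p.1⟩ p.2) x := fun p =>
      diffScheduler_prob_lift D E ⟨π₀.loc, π₀.act, p.1⟩ p.2 x
    simp only [h]
    exact measurable_diffDecision _ (hD n _ _) (hE n _ _) x
  · have h' : ∀ p : (Fin n → ℝ) × ℝ, ¬ ∃ π₀ : TimedPath L Act n, π₀.lift = ⟨loc, act, p.1⟩ :=
      fun p ⟨π₀, h₀⟩ => h ⟨π₀, by rw [h₀], by rw [h₀]⟩
    simp only [Scheduler.diffScheduler, h', dite_false]
    exact measurable_const
      (a := if x = (M.diff.exists_enabled (loc (Fin.last n))).choose then (1 : ℝ≥0) else 0)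

/-- Almost every path of the comparison CTMDP that has not reached the fresh location is a path of
the original CTMDP. -/
theorem last_eq_none_or_exists_lift {S : M.diff.Scheduler} {T : ℝ} {n : ℕ}
    {π : TimedPath (Option L) (Option (Act ⊕ Act × Act)) n} (h : S.stepDensity T π ≠ 0) :
    π.last = none ∨ ∃ π₀ : TimedPath L Act n, π₀.lift = π := by
  induction n with
  | zero =>
    obtain ⟨loc, act, time⟩ := π
    have h0 : ((M.diff.init (loc 0) : ℝ≥0) : ℝ≥0∞) ≠ 0 := h
    rcases hl : loc 0 with _ | l
    · simp [hl, diff] at h0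
    · refine Or.inr ⟨⟨fun _ => l, Fin.elim0, time⟩, ?_⟩
      simp only [TimedPath.lift, TimedPath.mk.injEq, and_true]
      refine ⟨funext fun i => ?_, funext fun i => i.elim0⟩
      rw [show i = 0 from Fin.ext (by simp), hl]
  | succ n ih =>
    obtain ⟨h1, -, h2⟩ := rate_ne_zero_of_stepDensity_ne_zero h
    rcases ih h1 with h3 | ⟨π₀, h3⟩
    · left
      rw [h3] at h2
      by_contra hl
      obtain ⟨l, hl⟩ := Option.ne_none_iff_exists'.1 hl
      rw [hl] at h2
      generalize π.act (Fin.last n) = x at h2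
      rcases x with _ | (a | ⟨a, b⟩) <;> exact h2 rfl
    · rcases hl : π.last with _ | l
      · exact Or.inl rfl
      · right
        rw [← h3, hl] at h2
        have h4 : ∃ a, π.act (Fin.last n) = some (Sum.inl a) := by
          generalize π.act (Fin.last n) = x at h2
          rcases x with _ | (a | ⟨a, b⟩)
          · exact (h2 rfl).elim
          · exact ⟨a, rfl⟩
          · exact (h2 rfl).elim
        obtain ⟨a, ha⟩ := h4
        refine ⟨π₀.snoc l a π.now, ?_⟩
        rw [TimedPath.lift_snoc, h3, ← ha, ← hl, TimedPath.snoc_dropLast]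

/-- If the value of every old location is `h ≥ 0` and that of the fresh location is `1`, then the
value grows at most at the rate at which the fresh location is entered. -/
theorem generator_diffScheduler_le (D E : M.Scheduler) {v : Option L → ℝ → ℝ} {h : ℝ → ℝ}
    (hv : ∀ l t, v (some l) t = h t) (hv1 : ∀ t, v none t = 1) {n : ℕ} (π : TimedPath L Act n)
    {t : ℝ} (ht : 0 ≤ h t) :
    (D.diffScheduler E).generator v π.lift t ≤
      2 * M.rateBound * (1 - ∑ a, min (D.prob π t a) (E.prob π t a) : ℝ≥0) := by
  classical
  have hlast : π.lift.last = some π.last := rfl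
  have hsum : ∑ ab : Act × Act, M.diffDecision π.last (D.prob π t) (E.prob π t) (some (Sum.inr ab)) =
      1 - ∑ a, min (D.prob π t a) (E.prob π t a) := by
    simp only [diffDecision]
    rw [Finset.sum_ite_eq']
    simp
  simp only [generator, diffScheduler_prob_lift, hlast, Fintype.sum_option, Fintype.sum_sum_type,
    hv, hv1, sub_self, mul_zero, Finset.sum_const_zero, add_zero]
  have h0 : (M.diffDecision π.last (D.prob π t) (E.prob π t) none : ℝ) = 0 := rfl
  have h1 : ∀ a, (M.diff.rate (some π.last) (some (Sum.inl a)) none : ℝ) = 0 := fun a => rfl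
  simp only [h0, h1, zero_mul, mul_zero, Finset.sum_const_zero, zero_add]
  rw [← hsum, NNReal.coe_sum, Finset.mul_sum]
  refine Finset.sum_le_sum fun ab _ => ?_
  rw [mul_comm]
  refine mul_le_mul_of_nonneg_right ?_ NNReal.zero_le_coe
  have h2 : (M.diff.rate (some π.last) (some (Sum.inr ab)) none : ℝ) =
      M.exitRate π.last ab.1 + M.exitRate π.last ab.2 := rfl
  have h3 : (M.exitRate π.last ab.1 : ℝ) ≤ M.rateBound := M.exitRate_le_rateBound _ _
  have h4 : (M.exitRate π.last ab.2 : ℝ) ≤ M.rateBound := M.exitRate_le_rateBound _ _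
  rw [h2]
  have h5 : (0 : ℝ) ≤ M.exitRate π.last ab.1 + M.exitRate π.last ab.2 := by positivity
  have h6 := mul_nonneg h5 ht
  linarith

/-- The difference measure of two schedulers that take the same decisions outside the set `D` of
times is at most proportional to the measure of `D`. -/
theorem schedDist_le {S S' : M.Scheduler} (hS : S.IsBorel) (hS' : S'.IsBorel) {T : ℝ} (hT : 0 ≤ T)
    {D : Set ℝ} (hD : MeasurableSet D)
    (heq : ∀ (n : ℕ) (π : TimedPath L Act n), ∀ t ∈ Set.Icc 0 T, t ∉ D →
      S.prob π t = S'.prob π t) :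
    S.schedDist S' T ≤ ENNReal.ofReal (2 * M.rateBound) * volume D := by
  set c : ℝ := 2 * M.rateBound with hc
  have hc0 : 0 ≤ c := by positivity
  have hpot := isPotential_diff (L := L) (T := T) hD hc0
  have key := (hS.diffScheduler hS').pathProb_le hT (A := fun π => π.Visits M.diff.goal) hpot
    (fun n π h t ht => ?_) (fun n π h hA => ?_)
  · refine key.trans ?_
    have h1 : ENNReal.ofReal (∫ u in (0 : ℝ)..T, D.indicator (fun _ => c) u) ≤
        ENNReal.ofReal c * volume D := by
      rw [intervalIntegral.integral_of_le hT, ofReal_integral_eq_lintegral_ofReal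
        (((integrable_const c).indicator hD)) (ae_of_all _ fun u =>
          Set.indicator_nonneg (fun _ _ => hc0) u), ← lintegral_indicator_const hD]
      refine (setLIntegral_le_lintegral _ _).trans (lintegral_mono fun u => ?_)
      by_cases hu : u ∈ D <;> simp [hu]
    calc _ = ∑ l, (M.init l : ℝ≥0∞) *
          ENNReal.ofReal (∫ u in (0 : ℝ)..T, D.indicator (fun _ => c) u) := by
          simp [Fintype.sum_option, diff]
      _ = ENNReal.ofReal (∫ u in (0 : ℝ)..T, D.indicator (fun _ => c) u) := by
          rw [← Finset.sum_mul, ← ENNReal.ofNNReal_finsetSum, M.sum_init, ENNReal.coe_one, one_mul]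
      _ ≤ _ := h1
  · rcases last_eq_none_or_exists_lift h with h1 | ⟨π₀, rfl⟩
    · have h2 : ∀ x l, M.diff.rate none x (some l) = 0 := by
        rintro (_ | _ | _) l <;> rfl
      rw [generator]
      simp [h1, Fintype.sum_option, h2]
    · refine (generator_diffScheduler_le S S'
        (v := fun l t => l.elim 1 fun _ => ∫ u in t..T, D.indicator (fun _ => c) u)
        (h := fun t => ∫ u in t..T, D.indicator (fun _ => c) u)
        (fun _ _ => rfl) (fun _ => rfl) π₀
        (hpot.nonneg (some π₀.last) t ht)).trans ?_
      change _ ≤ D.indicator (fun _ => c) t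
      by_cases htD : t ∈ D
      · rw [Set.indicator_of_mem htD]
        refine mul_le_of_le_one_right hc0 ?_
        exact_mod_cast tsub_le_self
      · rw [Set.indicator_of_notMem htD, heq n π₀ t ht htD]
        simp [S'.sum_prob]
  · rw [(visits_goal_iff h).1 hA]
    exact le_rfl

/-! ### Positional schedulers and their approximation -/

open Classical in
/-- The TPD scheduler that takes the action `σ l t` in the location `l` at time `t`. -/
def ofPolicy (σ : L → ℝ → Act) (hσ : ∀ l t, M.Enabled l (σ l t)) : M.Scheduler where
  prob π t a := if a = σ π.last t then 1 else 0
  sum_prob π t := by simp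
  enabled π t a h := by
    have : a = σ π.last t := by
      by_contra h'
      simp [h'] at h
    exact this ▸ hσ _ _

theorem isTPD_ofPolicy (σ : L → ℝ → Act) (hσ : ∀ l t, M.Enabled l (σ l t)) :
    (ofPolicy σ hσ).IsTPD :=
  ⟨σ, fun _ _ _ _ => rfl⟩

theorem isBorel_ofPolicy {σ : L → ℝ → Act} {hσ : ∀ l t, M.Enabled l (σ l t)}
    (hm : ∀ l a, MeasurableSet {t | σ l t = a}) : (ofPolicy σ hσ).IsBorel := by
  classical
  intro n loc act a
  refine Measurable.ite ?_ measurable_const measurable_const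
  have hsnd : Measurable (Prod.snd : (Fin n → ℝ) × ℝ → ℝ) := measurable_snd
  have h := hsnd (hm (loc (Fin.last n)) a)
  convert h using 1
  ext p
  exact eq_comm

theorem generator_ofPolicy (σ : L → ℝ → Act) (hσ : ∀ l t, M.Enabled l (σ l t)) (v : L → ℝ → ℝ)
    {n : ℕ} (π : TimedPath L Act n) (t : ℝ) :
    (ofPolicy σ hσ).generator v π t = M.drift (fun l => v l t) π.last (σ π.last t) := by
  classical
  simp [generator, ofPolicy, drift, apply_ite NNReal.toReal]

theorem monotone_cell (B : Finset ℝ) : Monotone (cell B) := fun _ _ h =>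
  Finset.card_le_card (Finset.monotone_filter_right _ fun _ _ hb => lt_of_lt_of_le hb h)

theorem cell_lt_cell {B : Finset ℝ} {s t b : ℝ} (hb : b ∈ B) (hs : s ≤ b) (ht : b < t) :
    cell B s < cell B t := by
  refine Finset.card_lt_card (Finset.ssubset_iff_of_subset
    (Finset.monotone_filter_right _ fun c _ hc => hc.trans (hs.trans_lt ht)) |>.2
    ⟨b, Finset.mem_filter.2 ⟨hb, ht⟩, fun h => ?_⟩)
  exact absurd (Finset.mem_filter.1 h).2 (not_lt.2 hs)

/-- The interval `[0,T]` has partitions of arbitrarily small mesh. -/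
theorem exists_partition {T δ : ℝ} (hT : 0 ≤ T) (hδ : 0 < δ) :
    ∃ B : Finset ℝ, (∀ b ∈ B, 0 ≤ b ∧ b ≤ T) ∧ T ∈ B ∧
      ∀ s ∈ Set.Icc 0 T, ∀ t ∈ Set.Icc 0 T, cell B s = cell B t → dist s t ≤ δ := by
  classical
  set B : Finset ℝ := (Finset.range (⌈T / δ⌉₊ + 1)).image fun i : ℕ => min (i * δ) T with hB
  have hmem : ∀ i : ℕ, i ≤ ⌈T / δ⌉₊ → min (i * δ) T ∈ B := fun i hi =>
    Finset.mem_image.2 ⟨i, Finset.mem_range.2 (Nat.lt_succ_of_le hi), rfl⟩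
  have key : ∀ s ∈ Set.Icc 0 T, ∀ t ∈ Set.Icc 0 T, cell B s = cell B t → t ≤ s + δ := by
    intro s hs t ht h
    by_contra! hlt
    have h1 : s ≤ ⌈s / δ⌉₊ * δ := (div_le_iff₀ hδ).1 (Nat.le_ceil _)
    have h2 : ⌈s / δ⌉₊ * δ < t := by
      have := Nat.ceil_lt_add_one (div_nonneg hs.1 hδ.le)
      calc _ < (s / δ + 1) * δ := by gcongr
        _ = s + δ := by field_simp
        _ < t := hlt
    have h3 := hmem ⌈s / δ⌉₊ (Nat.ceil_mono (by gcongr; exact hs.2))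
    rw [min_eq_left (h2.le.trans ht.2)] at h3
    exact (cell_lt_cell h3 h1 h2).ne h
  refine ⟨B, ?_, ?_, fun s hs t ht h => ?_⟩
  · intro b hb
    obtain ⟨i, -, rfl⟩ := Finset.mem_image.1 hb
    exact ⟨le_min (by positivity) hT, min_le_right _ _⟩
  · have h := hmem ⌈T / δ⌉₊ le_rfl
    rwa [min_eq_right ((div_le_iff₀ hδ).1 (Nat.le_ceil _))] at h
  · rw [Real.dist_eq, abs_le]
    constructor <;> linarith [key s hs t ht h, key t ht s hs h.symm]

/-- A Borel policy agrees, outside a set of times of small measure, with a cylindrical scheduler. -/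
theorem exists_cylindrical_approx {σ : L → ℝ → Act} (hσ : ∀ l t, M.Enabled l (σ l t))
    (hm : ∀ l a, MeasurableSet {t | σ l t = a}) {T : ℝ} (hT : 0 ≤ T) {ε : ℝ≥0∞} (hε : ε ≠ 0) :
    ∃ C : M.Scheduler, C.IsCylindrical T ∧ C.IsBorel ∧ ∃ D : Set ℝ, MeasurableSet D ∧
      volume D ≤ ε ∧ ∀ (n : ℕ) (π : TimedPath L Act n), ∀ t ∈ Set.Icc 0 T, t ∉ D →
        C.prob π t = (ofPolicy σ hσ).prob π t := by
  classical
  set A : L → Act → Set ℝ := fun l a => Set.Icc 0 T ∩ {t | σ l t = a} with hA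
  have hAm : ∀ l a, MeasurableSet (A l a) := fun l a => measurableSet_Icc.inter (hm l a)
  have hAfin : ∀ l a, volume (A l a) ≠ ∞ := fun l a =>
    measure_ne_top_of_subset Set.inter_subset_left (by simp)
  set N : ℝ≥0∞ := (Fintype.card (L × Act) : ℝ≥0∞) with hN
  have hε' : ε / N ≠ 0 := (ENNReal.div_pos hε (ENNReal.natCast_ne_top _)).ne'
  -- On disjoint compact sets, which are at positive distance, the policy is locally constant.
  choose K hKA hK hKε using fun l a =>
    (hAm l a).exists_isCompact_sdiff_lt (μ := volume) (hAfin l a) hε'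
  have hsep : ∀ᶠ δ : ℝ in 𝓝[>] 0, ∀ l a b, a ≠ b → ∀ s ∈ K l a, ∀ t ∈ K l b, δ < dist s t := by
    simp only [eventually_all]
    intro l a b hab
    have hdisj : Disjoint (K l a) (K l b) := Set.disjoint_left.2 fun t ha hb =>
      hab ((hKA l a ha).2.symm.trans (hKA l b hb).2)
    obtain ⟨r, hr, h⟩ := Metric.exists_pos_forall_lt_edist (hK l a) (hK l b).isClosed hdisj
    filter_upwards [Ioo_mem_nhdsGT (NNReal.coe_pos.2 hr)] with δ hδ s hs t ht
    have h1 := h s hs t ht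
    rw [edist_nndist, ENNReal.coe_lt_coe] at h1
    exact hδ.2.trans (NNReal.coe_lt_coe.2 h1)
  obtain ⟨δ, hδ, hδ0⟩ := (hsep.and self_mem_nhdsWithin).exists
  obtain ⟨B, hB, hTB, hmesh⟩ := exists_partition hT hδ0
  set g : L → ℕ → Act := fun l c =>
    if h : ∃ s, cell B s = c ∧ ∃ a, s ∈ K l a then σ l h.choose else (M.exists_enabled l).choose
    with hg
  have hgen : ∀ l c, M.Enabled l (g l c) := by
    intro l c
    simp only [hg]
    split_ifs
    · exact hσ _ _
    · exact (M.exists_enabled l).choose_spec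
  refine ⟨ofPolicy (fun l t => g l (cell B t)) fun l t => hgen _ _, ?_, ?_,
    ⋃ l, ⋃ a, A l a \ K l a, ?_, ?_, ?_⟩
  · refine ⟨B, hB, hTB, fun n π π' t t' hloc _ _ ht => ?_⟩
    have hlast : π.last = π'.last := congrFun hloc _
    simp only [ofPolicy, hlast, ht]
  · exact isBorel_ofPolicy fun l a =>
      (monotone_cell B).measurable (MeasurableSet.of_discrete (s := {c | g l c = a}))
  · exact MeasurableSet.iUnion fun l => MeasurableSet.iUnion fun a =>
      (hAm l a).diff (hK l a).measurableSet
  · calc volume (⋃ l, ⋃ a, A l a \ K l a) ≤ ∑ l, ∑ a, volume (A l a \ K l a) :=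
          (measure_iUnion_fintype_le _ _).trans
            (Finset.sum_le_sum fun l _ => measure_iUnion_fintype_le _ _)
      _ ≤ ∑ l : L, ∑ a : Act, ε / N :=
          Finset.sum_le_sum fun l _ => Finset.sum_le_sum fun a _ => (hKε l a).le
      _ = N * (ε / N) := by simp [hN, mul_assoc]
      _ ≤ ε := ENNReal.mul_div_le
  · intro n π t ht htD
    have htK : ∀ l, t ∈ K l (σ l t) := by
      intro l
      by_contra h
      exact htD (Set.mem_iUnion₂.2 ⟨l, σ l t, ⟨ht, rfl⟩, h⟩)
    have heq : ∀ l, g l (cell B t) = σ l t := by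
      intro l
      have h : ∃ s, cell B s = cell B t ∧ ∃ a, s ∈ K l a := ⟨t, rfl, _, htK l⟩
      simp only [hg, h, dite_true]
      obtain ⟨hcell, a, ha⟩ := h.choose_spec
      rw [(hKA l a ha).2]
      by_contra hne
      exact absurd (hmesh _ (hKA l a ha).1 t ht hcell) (not_le.2 (hδ l _ _ hne _ ha t (htK l)))
    funext a
    simp only [ofPolicy, heq]

/-- A TPD scheduler with a Borel policy is measurable. -/
theorem isMeasurable_ofPolicy {σ : L → ℝ → Act} (hσ : ∀ l t, M.Enabled l (σ l t))
    (hm : ∀ l a, MeasurableSet {t | σ l t = a}) {T : ℝ} (hT : 0 ≤ T) :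
    (ofPolicy σ hσ).IsMeasurable T := by
  refine ⟨isBorel_ofPolicy hm, ?_⟩
  choose C hC hCB D hD hDε heq using fun k : ℕ =>
    exists_cylindrical_approx hσ hm hT (ε := (k : ℝ≥0∞)⁻¹) (by simp)
  refine ⟨C, hC, ?_⟩
  have lim := ENNReal.Tendsto.const_mul (a := ENNReal.ofReal (2 * M.rateBound))
    ENNReal.tendsto_inv_nat_nhds_zero (Or.inr ENNReal.ofReal_ne_top)
  rw [mul_zero] at lim
  refine tendsto_of_tendsto_of_tendsto_of_le_of_le tendsto_const_nhds lim (fun _ => zero_le)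
    fun k => ?_
  exact (schedDist_le (hCB k) (isBorel_ofPolicy hm) hT (hD k) (heq k)).trans
    (mul_le_mul_right (hDε k) _)

end Scheduler

end CTMDP

/-! ### Optimal policies -/

theorem IsPotential.one_sub {L : Type*} {T : ℝ} {v k : L → ℝ → ℝ} (h : IsPotential T v k)
    (hv : ∀ l, ∀ t ∈ Set.Icc 0 T, v l t ≤ 1) :
    IsPotential T (fun l t => 1 - v l t) fun l t => -k l t where
  continuous l := continuous_const.sub (h.continuous l)
  nonneg l t ht := sub_nonneg.2 (hv l t ht)
  locallyIntegrable l := (h.locallyIntegrable l).neg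
  eq_add_integral l t ht := by
    rw [h.eq_add_integral l t ht, intervalIntegral.integral_neg]
    ring

namespace CTMDP

variable {L Act : Type*} [Fintype L] [Fintype Act] {M : CTMDP L Act}

namespace Scheduler

theorem generator_one_sub (S : M.Scheduler) (v : L → ℝ → ℝ) {n : ℕ} (π : TimedPath L Act n)
    (t : ℝ) : S.generator (fun l t => 1 - v l t) π t = -S.generator v π t := by
  rw [generator, generator, ← Finset.sum_neg_distrib]
  refine Finset.sum_congr rfl fun a _ => ?_
  rw [← mul_neg, ← Finset.sum_neg_distrib]
  congr 1
  refine Finset.sum_congr rfl fun l _ => ?_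
  ring

theorem minDrift_le_generator (S : M.Scheduler) (v : L → ℝ → ℝ) {n : ℕ} (π : TimedPath L Act n)
    (t : ℝ) : M.minDrift (fun l => v l t) π.last ≤ S.generator v π t := by
  calc M.minDrift (fun l => v l t) π.last
      = ∑ a, (S.prob π t a : ℝ) * M.minDrift (fun l => v l t) π.last := by
        rw [← Finset.sum_mul, sum_prob_real, one_mul]
    _ ≤ _ := by
        refine Finset.sum_le_sum fun a _ => ?_
        rcases eq_or_ne (S.prob π t a) 0 with h | h
        · simp [h]
        · exact mul_le_mul_of_nonneg_left (minDrift_le _ (S.enabled π t a h)) NNReal.zero_le_coe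

end Scheduler

/-- There is a Borel policy that always takes an action of least drift. -/
theorem exists_measurable_argmin (M : CTMDP L Act) {v : L → ℝ → ℝ} (hv : ∀ l, Continuous (v l)) :
    ∃ σ : L → ℝ → Act, (∀ l t, M.Enabled l (σ l t)) ∧ (∀ l a, MeasurableSet {t | σ l t = a}) ∧
      ∀ l t, M.drift (fun l => v l t) l (σ l t) = M.minDrift (fun l => v l t) l := by
  classical
  set O : L → ℝ → Set Act := fun l t =>
    {a | M.Enabled l a ∧ M.drift (fun l => v l t) l a = M.minDrift (fun l => v l t) l} with hO
  -- Select from the set of optimal actions by a function of this set, which is the same at all times.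
  set g : L → Set Act → Act := fun l s =>
    if h : s.Nonempty then h.some else (M.exists_enabled l).choose with hg
  have hmem : ∀ l t, g l (O l t) ∈ O l t := by
    intro l t
    have h : (O l t).Nonempty := M.exists_drift_eq_minDrift _ l
    simp only [hg, h, dite_true]
    exact h.some_mem
  refine ⟨fun l t => g l (O l t), fun l t => (hmem l t).1, fun l a => ?_, fun l t => (hmem l t).2⟩
  refine measurableSet_setOf_selection (fun a => ?_) (g l) a
  have hvc : Continuous fun t l => v l t := continuous_pi hv
  have h1 : Continuous fun t => M.drift (fun l => v l t) l a :=
    continuous_finsetSum _ fun l' _ => ((hv l').sub (hv l)).const_mul _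
  have h2 : Continuous fun t => M.minDrift (fun l => v l t) l :=
    (continuous_apply l).comp ((lipschitzWith_minDrift M).continuous.comp hvc)
  exact (MeasurableSet.const _).inter (isClosed_eq h1 h2).measurableSet

end CTMDP

end

theorem theorem2 {L Act : Type*} [Fintype L] [Fintype Act] (M : CTMDP L Act)
    (T : ℝ) (hT : 0 ≤ T) :
    ∃ S : M.Scheduler, S.IsTPD ∧ S.IsMeasurable T ∧
      ∀ S' : M.Scheduler, S'.IsMeasurable T →
        S.reachProb T ≤ S'.reachProb T ∧ S'.safeProb T ≤ S.safeProb T := by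
  classical
  obtain ⟨v, hvc, hv, hvT, hvk⟩ := M.exists_bellman_solution hT
  obtain ⟨σ, hσ, hm, hopt⟩ := M.exists_measurable_argmin hvc
  have hpot : IsPotential T v fun l t => M.minDrift (fun l => v l t) l := by
    refine ⟨hvc, fun l t _ => (hv l t).1, fun l => Continuous.locallyIntegrable ?_, hvk⟩
    exact (continuous_apply l).comp
      ((CTMDP.lipschitzWith_minDrift M).continuous.comp (continuous_pi hvc))
  have hv1 : ∀ l, ∀ t ∈ Set.Icc 0 T, v l t ≤ 1 := fun l t _ => (hv l t).2
  have hpot' := hpot.one_sub hv1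
  have hB := CTMDP.Scheduler.isBorel_ofPolicy (hσ := hσ) hm
  have hgen : ∀ (n : ℕ) (π : TimedPath L Act n) (t : ℝ),
      (CTMDP.Scheduler.ofPolicy σ hσ).generator v π t = M.minDrift (fun l => v l t) π.last :=
    fun n π t => by rw [CTMDP.Scheduler.generator_ofPolicy, hopt]
  refine ⟨CTMDP.Scheduler.ofPolicy σ hσ, CTMDP.Scheduler.isTPD_ofPolicy σ hσ,
    CTMDP.Scheduler.isMeasurable_ofPolicy hσ hm hT, fun S' hS' => ⟨?_, ?_⟩⟩
  · refine (hB.pathProb_le hT hpot (fun n π _ t _ => (hgen n π t).le) fun n π h hπ => ?_).trans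
      (hS'.1.le_pathProb hT hpot hv1 (fun n π _ t _ => S'.minDrift_le_generator v π t)
        fun n π h hπ => ?_)
    · rw [hvT, if_pos ((CTMDP.Scheduler.visits_goal_iff h).1 hπ)]
    · rw [hvT, if_neg fun h' => hπ ((CTMDP.Scheduler.visits_goal_iff h).2 h')]
  · refine (hS'.1.pathProb_le hT hpot' (fun n π _ t _ => ?_) fun n π h hπ => ?_).trans
      (hB.le_pathProb hT hpot' (fun l t _ => sub_le_self _ (hv l t).1) (fun n π _ t _ => ?_)
        fun n π h hπ => ?_)
    · rw [CTMDP.Scheduler.generator_one_sub]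
      exact neg_le_neg (S'.minDrift_le_generator v π t)
    · rw [hvT, if_neg fun h' => hπ ((CTMDP.Scheduler.visits_goal_iff h).2 h'), sub_zero]
    · rw [CTMDP.Scheduler.generator_one_sub, hgen]
    · rw [hvT, if_pos ((CTMDP.Scheduler.visits_goal_iff h).1 (not_not.1 hπ)), sub_self]
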